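/- Fix $n\ge 0$ and let $\mathbb D\subset\mathbb R^n$ be the open unit disk. \textbf{Operads with shifts.} Let $\mathscr O$ be a symmetric operad in topological spaces with colour set $\{1,2\}$; for a list $\ell=l_1\dots l_p$ of colours write $\mathscr O(\ell;c)$ for its spaces of operations, and order lists of equal length entrywise. An \emph{operad with shifts} is such an $\mathscr O$ with $\mathscr O(\ell;2)$ a point if $\ell=2$ and empty otherwise, together with weak homotopy equivalences $\mathfrak s_{\ell,\ell'}:\mathscr O(\ell;1)\to\mathscr O(\ell';1)$ for $\ell\le\ell'$ satisfying $\mathfrak s_{\ell',\ell''}\mathfrak s_{\ell,\ell'}=\mathfrak s_{\ell,\ell''}$, $\mathfrak s_{\ell,\ell}=\mathrm{id}$, $(\mathfrak s_{\ell,\ell'}x)\circ_i(\mathfrak s_{\ell'',\ell'''}y)=\mathfrak s_{\ell\circ_i\ell'',\,\ell'\circ_i\ell'''}(x\circ_i y)$ whenever $\ell\le\ell'$, $\ell''\le\ell'''$ and $l_i=l'_i=1$, and $\sigma^*\mathfrak s_{\ell,\ell'}=\mathfrak s_{\ell\sigma,\ell'\sigma}\sigma^*$ for permutations $\sigma$.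 \textbf{The operad of points and little disks.} Let $\mathscr O(\ell;2)$ be a point if $\ell=2$ and empty otherwise. A point of $\mathscr O(\ell;1)$ consists of an affine map $a_i(t)=r_it+c_i$ with $r_i>0$ and $D_i:=a_i(\mathbb D)\subseteq\mathbb D$ for each $i$ with $l_i=1$, recorded as the pair $(r_i,c_i)\in\mathbb R\times\mathbb R^n$, and a point $d_i\in\mathbb D$ for each $i$ with $l_i=2$, such that for $i\ne j$ one has $D_i\cap D_j=\varnothing$, $d_i\ne d_j$ and $d_i\notin\overline{D_j}$ whenever these are defined; it carries the subspace topology of the corresponding product of copies of $\mathbb R\times\mathbb R^n$ and $\mathbb R^n$. If $l_i=1$, then $\mathbf x\circ_i\mathbf y$ is obtained by replacing the entry $a_i$ of $\mathbf x$ by the images under $a_i$ of the disks and points of $\mathbf y$; the identity of colour $1$ is $(1,0)$, the only operation in $\mathscr O(2;2)$ is the identity of colour $2$, and the symmetric groups permute the entries. For $\ell\le\ell'$ let $\mathfrak s_{\ell,\ell'}$ replace $a_i$ by its centre $a_i(0)$ for each $i$ with $l_i=1$, $l'_i=2$, and leave the other entries unchanged. \textbf{Semi-dendroidal spaces.} Let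 $\Omega$ be the dendroidal category: its objects are finite rooted trees $T$, and maps $S\to T$ are maps of coloured operads $\Omega(S)\to\Omega(T)$, where $\Omega(T)$ is the operad freely generated by the vertices of $T$, with the edges of $T$ as colours. Let $\Omega_{\mathrm{inj}}$ be the wide subcategory generated by isomorphisms and face maps. A semi-dendroidal space is a presheaf $X$ of topological spaces on $\Omega_{\mathrm{inj}}$. It satisfies the \emph{Segal condition} if $X_\eta$ is a point, where $\eta$ is the tree with one edge and no vertices, and for every tree $T\ne\eta$ the map $X_T\to\prod_{v}X_{C_v}$ induced by the inclusions $C_v\to T$ of the corollas at the vertices $v$ of $T$ is a weak homotopy equivalence. The semi-dendroidal space $X$ \emph{associated} with an operad with shifts $(\mathscr O,\mathfrak s)$ has $X_\eta=*$; for $T\neq\eta$, $X_T$ is the subspace of the space $N_d(\mathscr O)_T$ of operad maps $\Omega(T)\to\mathscr O$ consisting of the maps which send all leaves of $T$ to $2$ and the root and all inner edges to $1$. For a map $\alpha:S\to T$ of $\Omega_{\mathrm{inj}}$ with $S\neq\eta$, the map $X_T\to X_S$ restricts $x:\Omega(T)\to\mathscr O$ along $\alpha$, recolours the leaves of $S$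 by $2$, and applies to the value at each vertex of $S$ the corresponding shift map. \textbf{Statement.} \begin{enumerate} \item The operad of points and little disks with the maps $\mathfrak s_{\ell,\ell'}$ is an operad with shifts. \item Each of its shift maps $\mathfrak s_{\ell,\ell'}$ is a homotopy equivalence. \item The above spaces $X_T$ and maps, for the operad of points and little disks, constitute a semi-dendroidal space $X$. It satisfies the Segal condition, and for every $k\ge 0$ its value $X_{C_k}$ at the $k$-corolla is homeomorphic to the ordered configuration space $\{(p_1,\dots,p_k)\in\mathbb D^k : p_i\ne p_j \text{ for } i\neq j\}$, by the map which sends an operad map $\Omega(C_k)\to\mathscr O$ to its value in $\mathscr O(2\cdots2;1)$ at the vertex of $C_k$. \end{enumerate} -/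

import Mathlib

open CategoryTheory Topology

/-! ## Coloured symmetric operads in topological spaces

Lists of colours are indexed by arbitrary finite sets: a list `l₁ … l_p` is a family
`c : I → C`, and the symmetric groups act through relabelling along bijections of index sets.
All operations carry their equations between colours as arguments, so that no casts occur. -/

/-- The list `c ∘_i c'`: the entry `i` of `c` is replaced by the list `c'`. -/
def substProfile {C : Type} {I J : Type} (c : I → C) (i : I) (c' : J → C) :
    {k : I // k ≠ i} ⊕ J → C :=
  Sum.elim (fun k => c k.1) c'

/-- Relabelling the host of a partial composition. -/
def hostEquiv {I I' : Type} (e : I ≃ I') (i : I) (J : Type) :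
    {k : I // k ≠ i} ⊕ J ≃ {k : I' // k ≠ e i} ⊕ J :=
  Equiv.sumCongr
    (e.subtypeEquiv (fun k => by simp)) (Equiv.refl J)

/-- Relabelling the guest of a partial composition. -/
def guestEquiv {I J J' : Type} (i : I) (e : J ≃ J') :
    {k : I // k ≠ i} ⊕ J ≃ {k : I // k ≠ i} ⊕ J' :=
  Equiv.sumCongr (Equiv.refl _) e

/-- Inputs of `id ∘ y` are the inputs of `y`. -/
def leftUnitEquiv (J : Type) : {k : Unit // k ≠ ()} ⊕ J ≃ J where
  toFun := Sum.elim (fun k => (k.2 rfl).elim) id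
  invFun := Sum.inr
  left_inv := by rintro (k | j); exacts [(k.2 rfl).elim, rfl]
  right_inv _ := rfl

/-- Inputs of `x ∘_i id` are the inputs of `x`. -/
noncomputable def rightUnitEquiv {I : Type} (i : I) : {k : I // k ≠ i} ⊕ Unit ≃ I where
  toFun := Sum.elim (fun k => k.1) (fun _ => i)
  invFun k := by
    classical
    exact if h : k = i then Sum.inr () else Sum.inl ⟨k, h⟩
  left_inv := by
    rintro (k | j)
    · simp [k.2]
    · simp
  right_inv k := by
    by_cases h : k = i <;> simp [h]

/-- Inputs of `(x ∘_i y) ∘_j z` and of `x ∘_i (y ∘_j z)`, for `j` an input of `y`. -/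
def seqEquiv {I J : Type} (i : I) (j : J) (L : Type) :
    {m : {k : I // k ≠ i} ⊕ J // m ≠ Sum.inr j} ⊕ L ≃
      {k : I // k ≠ i} ⊕ ({j' : J // j' ≠ j} ⊕ L) where
  toFun
    | Sum.inl ⟨Sum.inl k, _⟩ => Sum.inl k
    | Sum.inl ⟨Sum.inr j', h⟩ => Sum.inr (Sum.inl ⟨j', fun e => h (congrArg Sum.inr e)⟩)
    | Sum.inr l => Sum.inr (Sum.inr l)
  invFun
    | Sum.inl k => Sum.inl ⟨Sum.inl k, Sum.inl_ne_inr⟩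
    | Sum.inr (Sum.inl j') => Sum.inl ⟨Sum.inr j'.1, fun e => j'.2 (Sum.inr_injective e)⟩
    | Sum.inr (Sum.inr l) => Sum.inr l
  left_inv := by rintro (⟨k | j', h⟩ | l) <;> rfl
  right_inv := by rintro (k | ⟨j', h⟩ | l) <;> rfl

/-- Inputs of `(x ∘_i y) ∘_k z` and of `(x ∘_k z) ∘_i y`, for `i ≠ k` two inputs of `x`. -/
def parEquiv {I : Type} {i k : I} (hik : i ≠ k) (J L : Type) :
    {m : {m : I // m ≠ i} ⊕ J // m ≠ Sum.inl ⟨k, hik.symm⟩} ⊕ L ≃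
      {m : {m : I // m ≠ k} ⊕ L // m ≠ Sum.inl ⟨i, hik⟩} ⊕ J where
  toFun
    | Sum.inl ⟨Sum.inl m, h⟩ =>
        Sum.inl ⟨Sum.inl ⟨m.1, fun e => h (congrArg Sum.inl (Subtype.ext e))⟩,
          fun e => m.2 (congrArg Subtype.val (Sum.inl_injective e))⟩
    | Sum.inl ⟨Sum.inr j, _⟩ => Sum.inr j
    | Sum.inr l => Sum.inl ⟨Sum.inr l, Sum.inr_ne_inl⟩
  invFun
    | Sum.inl ⟨Sum.inl m, h⟩ =>
        Sum.inl ⟨Sum.inl ⟨m.1, fun e => h (congrArg Sum.inl (Subtype.ext e))⟩,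
          fun e => m.2 (congrArg Subtype.val (Sum.inl_injective e))⟩
    | Sum.inl ⟨Sum.inr l, _⟩ => Sum.inr l
    | Sum.inr j => Sum.inl ⟨Sum.inr j, Sum.inr_ne_inl⟩
  left_inv := by rintro (⟨m | j, h⟩ | l) <;> rfl
  right_inv := by rintro (⟨m | l, h⟩ | j) <;> rfl

/-- The structure maps of a coloured symmetric operad in topological spaces. -/
structure OperadData (C : Type) where
  /-- the space of operations with inputs coloured by `c` and output of colour `d` -/
  Op : {I : Type} → [Finite I] → (I → C) → C → Type
  top : {I : Type} → [Finite I] → (c : I → C) → (d : C) → TopologicalSpace (Op c d)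
  /-- identity operations -/
  one : (a : C) → Op (fun _ : Unit => a) a
  /-- symmetric group actions -/
  reindex : {I J : Type} → [Finite I] → [Finite J] → (e : I ≃ J) → {c : I → C} → {c' : J → C} →
    {d : C} → (∀ i, c' (e i) = c i) → Op c d → Op c' d
  /-- partial compositions `x ∘_i y` -/
  circ : {I J : Type} → [Finite I] → [Finite J] → (i : I) → {c : I → C} → {c' : J → C} →
    {a d : C} → c i = a → Op c d → Op c' a → Op (substProfile c i c') d

attribute [instance] OperadData.top

/-- Replace the output colour by an equal one. -/
def OperadData.recolor {C : Type} (O : OperadData C) {I : Type} [Finite I] {c : I → C} {d d' : C}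
    (h : d = d') (x : O.Op c d) : O.Op c d' :=
  h ▸ x

/-- The axioms of a coloured symmetric operad in topological spaces. -/
structure OperadData.IsOperad {C : Type} (O : OperadData C) : Prop where
  continuous_reindex : ∀ {I J : Type} [Finite I] [Finite J] (e : I ≃ J) {c : I → C} {c' : J → C}
    {d : C} (h : ∀ i, c' (e i) = c i), Continuous (O.reindex e (d := d) h)
  continuous_circ : ∀ {I J : Type} [Finite I] [Finite J] (i : I) {c : I → C} {c' : J → C}
    {a d : C} (hi : c i = a),
    Continuous fun p : O.Op c d × O.Op c' a => O.circ i hi p.1 p.2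
  reindex_refl : ∀ {I : Type} [Finite I] {c : I → C} {d : C} (x : O.Op c d),
    O.reindex (Equiv.refl I) (fun _ => rfl) x = x
  reindex_trans : ∀ {I J K : Type} [Finite I] [Finite J] [Finite K] (e : I ≃ J) (e' : J ≃ K)
    {c : I → C} {c' : J → C} {c'' : K → C} {d : C} (h : ∀ i, c' (e i) = c i)
    (h' : ∀ j, c'' (e' j) = c' j) (x : O.Op c d),
    O.reindex e' h' (O.reindex e h x) =
      O.reindex (e.trans e') (fun i => (h' (e i)).trans (h i)) x
  reindex_circ : ∀ {I I' J : Type} [Finite I] [Finite I'] [Finite J] (e : I ≃ I') (i : I)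
    {c : I → C} {c₁ : I' → C} {c' : J → C} {a d : C} (h : ∀ k, c₁ (e k) = c k) (hi : c i = a)
    (x : O.Op c d) (y : O.Op c' a),
    O.circ (e i) ((h i).trans hi) (O.reindex e h x) y =
      O.reindex (hostEquiv e i J) (by rintro (k | j); exacts [h k.1, rfl]) (O.circ i hi x y)
  circ_reindex : ∀ {I J J' : Type} [Finite I] [Finite J] [Finite J'] (i : I) (e : J ≃ J')
    {c : I → C} {c' : J → C} {c₁ : J' → C} {a d : C} (h : ∀ k, c₁ (e k) = c' k) (hi : c i = a)
    (x : O.Op c d) (y : O.Op c' a),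
    O.circ i hi x (O.reindex e h y) =
      O.reindex (guestEquiv i e) (by rintro (k | j); exacts [rfl, h j]) (O.circ i hi x y)
  one_circ : ∀ {J : Type} [Finite J] {c : J → C} {a : C} (y : O.Op c a),
    O.reindex (leftUnitEquiv J) (by rintro (k | j); exacts [(k.2 rfl).elim, rfl])
      (O.circ () rfl (O.one a) y) = y
  circ_one : ∀ {I : Type} [Finite I] (i : I) {c : I → C} {a d : C} (hi : c i = a) (x : O.Op c d),
    O.reindex (rightUnitEquiv i) (by rintro (k | j); exacts [rfl, hi])
      (O.circ i hi x (O.one a)) = x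
  circ_circ : ∀ {I J L : Type} [Finite I] [Finite J] [Finite L] (i : I) (j : J) {c : I → C}
    {c' : J → C} {c'' : L → C} {a b d : C} (hi : c i = a) (hj : c' j = b)
    (x : O.Op c d) (y : O.Op c' a) (z : O.Op c'' b),
    O.reindex (seqEquiv i j L) (by rintro (⟨k | j', h⟩ | l) <;> rfl)
      (O.circ (Sum.inr j) hj (O.circ i hi x y) z) = O.circ i hi x (O.circ j hj y z)
  circ_comm : ∀ {I J L : Type} [Finite I] [Finite J] [Finite L] {i k : I} (hik : i ≠ k)
    {c : I → C} {c' : J → C} {c'' : L → C} {a b d : C} (hi : c i = a) (hk : c k = b)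
    (x : O.Op c d) (y : O.Op c' a) (z : O.Op c'' b),
    O.reindex (parEquiv hik J L) (by rintro (⟨m | j, h⟩ | l) <;> rfl)
      (O.circ (Sum.inl ⟨k, hik.symm⟩) hk (O.circ i hi x y) z) =
    O.circ (Sum.inl ⟨i, hik⟩) hi (O.circ k hk x z) y

/-- Maps of operads with prescribed effect `f` on colours. -/
@[ext]
structure OperadMap {C D : Type} (P : OperadData C) (Q : OperadData D) (f : C → D) where
  toFun : {I : Type} → [Finite I] → {c : I → C} → {d : C} →
    P.Op c d → Q.Op (fun i => f (c i)) (f d)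
  continuous_toFun : ∀ {I : Type} [Finite I] {c : I → C} {d : C},
    Continuous (toFun (c := c) (d := d))
  map_one : ∀ a : C, toFun (P.one a) = Q.one (f a)
  map_reindex : ∀ {I J : Type} [Finite I] [Finite J] (e : I ≃ J) {c : I → C} {c' : J → C} {d : C}
    (h : ∀ i, c' (e i) = c i) (x : P.Op c d),
    toFun (P.reindex e h x) = Q.reindex e (fun i => congrArg f (h i)) (toFun x)
  map_circ : ∀ {I J : Type} [Finite I] [Finite J] (i : I) {c : I → C} {c' : J → C} {a d : C}
    (hi : c i = a) (x : P.Op c d) (y : P.Op c' a),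
    toFun (P.circ i hi x y) =
      Q.reindex (Equiv.refl _) (by rintro (k | j) <;> rfl)
        (Q.circ i (congrArg f hi) (toFun x) (toFun y))

/-- The topology of pointwise convergence on the set of maps of operads over `f`. (It is used
for source operads that are discrete.) -/
instance {C D : Type} (P : OperadData C) (Q : OperadData D) (f : C → D) :
    TopologicalSpace (OperadMap P Q f) :=
  ⨅ (I : Type) (_ : Finite I) (c : I → C) (d : C) (x : P.Op c d),
    TopologicalSpace.induced (fun F : OperadMap P Q f => F.toFun x) inferInstance

/-! ## The dendroidal category -/

/-- Finite rooted trees: a vertex `v` has a set `inp v` of input edges and an output edge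
`out v`; from every edge a path leads down to the root. -/
structure DTree where
  E : Type
  V : Type
  [finE : Finite E]
  [finV : Finite V]
  inp : V → Set E
  out : V → E
  root : E
  out_injective : Function.Injective out
  inp_unique : ∀ {v w : V} {e : E}, e ∈ inp v → e ∈ inp w → v = w
  root_notMem : ∀ v, root ∉ inp v
  reach : ∀ e, Relation.ReflTransGen (fun a b => ∃ v, a ∈ inp v ∧ b = out v) e root

attribute [instance] DTree.finE DTree.finV

namespace DTree

/-- Leaves are the edges that are not the output of a vertex. -/
def IsLeaf (T : DTree) (e : T.E) : Prop := ∀ v, T.out v ≠ e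

/-- `T` is the tree `η` with a single edge and no vertices. -/
def IsTrivial (T : DTree) : Prop := IsEmpty T.V

/-- One step down the tree. -/
def Step (T : DTree) (a b : T.E) : Prop := ∃ v, a ∈ T.inp v ∧ b = T.out v

/-- `T.Subtree A e`: the tree `T` has a subtree with root `e` and set of leaves `A`. -/
inductive Subtree (T : DTree) : Set T.E → T.E → Prop
  | edge (e : T.E) : Subtree T {e} e
  | graft (v : T.V) (A : T.E → Set T.E) (h : ∀ e ∈ T.inp v, Subtree T (A e) e) :
      Subtree T (⋃ e ∈ T.inp v, A e) (T.out v)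

theorem step_rightUnique (T : DTree) : Relator.RightUnique T.Step := by
  rintro a b c ⟨v, hv, rfl⟩ ⟨w, hw, rfl⟩
  rw [T.inp_unique hv hw]

theorem not_transGen_self (T : DTree) (e : T.E) : ¬ Relation.TransGen T.Step e e := by
  intro h
  have key : Relation.TransGen T.Step T.root T.root := by
    have hr : Relation.ReflTransGen T.Step e T.root := T.reach e
    generalize T.root = r at hr
    induction hr with
    | refl => exact h
    | tail _ hbc ih =>
      obtain ⟨d, hd, hdb⟩ := Relation.TransGen.head'_iff.1 ih
      have := T.step_rightUnique hd hbc
      subst this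
      exact Relation.TransGen.tail' hdb hbc
  obtain ⟨d, ⟨v, hv, -⟩, -⟩ := Relation.TransGen.head'_iff.1 key
  exact T.root_notMem v hv

theorem Subtree.reach {T : DTree} {A : Set T.E} {e a : T.E} (h : T.Subtree A e)
    (ha : a ∈ A) : Relation.ReflTransGen T.Step a e := by
  induction h with
  | edge e => rw [Set.mem_singleton_iff.1 ha]
  | graft v A _ ih =>
    obtain ⟨b, hb, hab⟩ := Set.mem_iUnion₂.1 ha
    exact (ih b hb hab).tail ⟨v, hb, rfl⟩

/-- Distinct leaves of a subtree are incomparable. -/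
theorem Subtree.antichain {T : DTree} {A : Set T.E} {e a b : T.E} (h : T.Subtree A e)
    (ha : a ∈ A) (hb : b ∈ A) (hab : Relation.ReflTransGen T.Step a b) : a = b := by
  induction h with
  | edge e => rw [Set.mem_singleton_iff.1 ha, Set.mem_singleton_iff.1 hb]
  | graft v A hA ih =>
    obtain ⟨x, hx, hax⟩ := Set.mem_iUnion₂.1 ha
    obtain ⟨y, hy, hby⟩ := Set.mem_iUnion₂.1 hb
    have h1 := (hA x hx).reach hax
    have h2 := hab.trans ((hA y hy).reach hby)
    have aux : ∀ {x y : T.E}, x ∈ T.inp v → y ∈ T.inp v →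
        Relation.ReflTransGen T.Step x y → x = y := by
      intro x y hx hy hxy
      rcases Relation.ReflTransGen.cases_head hxy with rfl | ⟨d, hd, hdy⟩
      · rfl
      · have := T.step_rightUnique hd ⟨v, hx, rfl⟩
        subst this
        exact (T.not_transGen_self y (Relation.TransGen.head' ⟨v, hy, rfl⟩ hdy)).elim
    have hxy : x = y := by
      rcases Relation.ReflTransGen.total_of_right_unique T.step_rightUnique h1 h2 with h | h
      · exact aux hx hy h
      · exact (aux hy hx h).symm
    subst hxy
    exact ih x hx hax hby

/-- Grafting of subtrees. -/
theorem Subtree.subst {T : DTree} {A B : Set T.E} {a e : T.E} (h : T.Subtree A e)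
    (ha : a ∈ A) (hB : T.Subtree B a) : T.Subtree ((A \ {a}) ∪ B) e := by
  induction h with
  | edge e =>
    obtain rfl := Set.mem_singleton_iff.1 ha
    simpa using hB
  | graft v A hA ih =>
    classical
    have key : ((⋃ e ∈ T.inp v, A e) \ {a}) ∪ B =
        ⋃ e ∈ T.inp v, if a ∈ A e then (A e \ {a}) ∪ B else A e := by
      obtain ⟨x, hx, hax⟩ := Set.mem_iUnion₂.1 ha
      ext b
      simp only [Set.mem_union, Set.mem_sdiff, Set.mem_iUnion, Set.mem_singleton_iff]
      constructor
      · rintro (⟨⟨y, hy, hby⟩, hba⟩ | hb)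
        · refine ⟨y, hy, ?_⟩
          split_ifs
          · exact Or.inl ⟨hby, hba⟩
          · exact hby
        · refine ⟨x, hx, ?_⟩
          rw [if_pos hax]
          exact Or.inr hb
      · rintro ⟨y, hy, hby⟩
        split_ifs at hby with hay
        · rcases hby with hby | hby
          · exact Or.inl ⟨⟨y, hy, hby.1⟩, hby.2⟩
          · exact Or.inr hby
        · refine Or.inl ⟨⟨y, hy, hby⟩, ?_⟩
          rintro rfl
          exact hay hby
    rw [key]
    refine Subtree.graft v _ (fun e he => ?_)
    split_ifs with hae
    · exact ih e he hae
    · exact hA e he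

/-- The list `c` of edges, without repetition, enumerates the leaves of a subtree with
root `e`. -/
def IsOp (T : DTree) {I : Type} (c : I → T.E) (e : T.E) : Prop :=
  Function.Injective c ∧ T.Subtree (Set.range c) e

theorem isOp_one (T : DTree) (a : T.E) : T.IsOp (fun _ : Unit => a) a := by
  refine ⟨fun _ _ _ => rfl, ?_⟩
  rw [Set.range_const]
  exact Subtree.edge a

theorem IsOp.reindex {T : DTree} {I J : Type} (e : I ≃ J) {c : I → T.E} {c' : J → T.E}
    {d : T.E} (h : ∀ i, c' (e i) = c i) (hc : T.IsOp c d) : T.IsOp c' d := by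
  have h' : c' = c ∘ e.symm := by
    funext j
    simpa using h (e.symm j)
  subst h'
  refine ⟨hc.1.comp e.symm.injective, ?_⟩
  rw [e.symm.surjective.range_comp]
  exact hc.2

theorem IsOp.circ {T : DTree} {I J : Type} (i : I) {c : I → T.E} {c' : J → T.E} {a d : T.E}
    (hi : c i = a) (hc : T.IsOp c d) (hc' : T.IsOp c' a) : T.IsOp (substProfile c i c') d := by
  subst hi
  have aux : ∀ k j, k ≠ i → c k ≠ c' j := by
    intro k j hk hkj
    have h1 := hc'.2.reach ⟨j, rfl⟩
    rw [← hkj] at h1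
    exact hk (hc.1 (hc.2.antichain ⟨k, rfl⟩ ⟨i, rfl⟩ h1))
  constructor
  · rintro (k | j) (k' | j') h
    · exact congrArg Sum.inl (Subtype.ext (hc.1 h))
    · exact (aux k.1 j' k.2 h).elim
    · exact (aux k'.1 j k'.2 h.symm).elim
    · exact congrArg Sum.inr (hc'.1 h)
  · have : Set.range (substProfile c i c') = (Set.range c \ {c i}) ∪ Set.range c' := by
      ext b
      simp only [substProfile, Set.Sum.elim_range, Set.mem_union, Set.mem_sdiff, Set.mem_range,
        Set.mem_singleton_iff, Subtype.exists]
      refine or_congr_left ⟨?_, ?_⟩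
      · rintro ⟨k, hk, rfl⟩
        exact ⟨⟨k, rfl⟩, fun h => hk (hc.1 h)⟩
      · rintro ⟨⟨k, rfl⟩, hk⟩
        exact ⟨k, fun h => hk (congrArg c h), rfl⟩
    rw [this]
    exact hc.2.subst ⟨i, rfl⟩ hc'.2

theorem isOp_vertex (T : DTree) (v : T.V) :
    T.IsOp (fun e : T.inp v => e.1) (T.out v) := by
  refine ⟨Subtype.val_injective, ?_⟩
  have h := Subtree.graft v (fun e => {e}) (fun e _ => Subtree.edge (T := T) e)
  rw [Set.biUnion_of_singleton] at h
  simpa using h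

/-- The operad `Ω(T)`, freely generated by the vertices of `T`: its colours are the edges, and
there is exactly one operation `(e₁, …, e_p; e)` if `e₁, …, e_p` enumerate the leaves of a
subtree with root `e`, and none otherwise. -/
def operad (T : DTree) : OperadData T.E where
  Op c e := PLift (T.IsOp c e)
  top _ _ := ⊥
  one a := ⟨T.isOp_one a⟩
  reindex e _ _ _ h x := ⟨x.down.reindex e h⟩
  circ i _ _ _ _ hi x y := ⟨x.down.circ i hi y.down⟩

instance (T : DTree) {I : Type} [Finite I] (c : I → T.E) (e : T.E) :
    Subsingleton (T.operad.Op c e) :=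
  inferInstanceAs (Subsingleton (PLift (T.IsOp c e)))

instance (T : DTree) {I : Type} [Finite I] (c : I → T.E) (e : T.E) :
    DiscreteTopology (T.operad.Op c e) :=
  ⟨rfl⟩

theorem operad_isOperad (T : DTree) : T.operad.IsOperad where
  continuous_reindex _ _ _ _ _ := continuous_of_discreteTopology
  continuous_circ _ _ _ _ _ _ := continuous_of_discreteTopology
  reindex_refl _ := Subsingleton.elim _ _
  reindex_trans _ _ _ _ _ _ _ _ _ := Subsingleton.elim _ _
  reindex_circ _ _ _ _ _ _ _ _ _ _ _ := Subsingleton.elim _ _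
  circ_reindex _ _ _ _ _ _ _ _ _ _ _ := Subsingleton.elim _ _
  one_circ _ := Subsingleton.elim _ _
  circ_one _ _ _ _ _ _ := Subsingleton.elim _ _
  circ_circ _ _ _ _ _ _ _ _ _ _ _ _ _ := Subsingleton.elim _ _
  circ_comm _ _ _ _ _ _ _ _ _ _ _ _ := Subsingleton.elim _ _

/-- The generator of `Ω(T)` belonging to the vertex `v`. -/
def vertexOp (T : DTree) (v : T.V) :
    T.operad.Op (fun e : T.inp v => e.1) (T.out v) :=
  ⟨T.isOp_vertex v⟩

/-- Maps of trees `S → T` in `Ω` are maps of operads `Ω(S) → Ω(T)`. -/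
@[ext]
structure Hom (S T : DTree) where
  edge : S.E → T.E
  map : OperadMap S.operad T.operad edge

theorem Hom.ext_edge {S T : DTree} {f g : Hom S T} (h : f.edge = g.edge) : f = g := by
  obtain ⟨f, F⟩ := f
  obtain ⟨g, G⟩ := g
  obtain rfl : f = g := h
  congr
  ext
  exact Subsingleton.elim _ _

/-- The dendroidal category `Ω`. -/
instance : Category DTree where
  Hom := Hom
  id S :=
    { edge := id
      map :=
        { toFun := fun x => x
          continuous_toFun := continuous_id
          map_one := fun _ => rfl
          map_reindex := fun _ _ _ _ _ _ => rfl
          map_circ := fun _ _ _ _ _ _ _ _ => Subsingleton.elim _ _ } }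
  comp f g :=
    { edge := fun e => g.edge (f.edge e)
      map :=
        { toFun := fun x => g.map.toFun (f.map.toFun x)
          continuous_toFun := continuous_of_discreteTopology
          map_one := fun _ => Subsingleton.elim _ _
          map_reindex := fun _ _ _ _ _ _ => Subsingleton.elim _ _
          map_circ := fun _ _ _ _ _ _ _ _ => Subsingleton.elim _ _ } }
  id_comp _ := Hom.ext_edge rfl
  comp_id _ := Hom.ext_edge rfl
  assoc _ _ _ := Hom.ext_edge rfl

/-- The vertex `u'` of `S` corresponds to the vertex `u` of `T` under `f`. -/
def VertexOver {S T : DTree} (f : S ⟶ T) (u' : S.V) (u : T.V) : Prop :=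
  f.edge (S.out u') = T.out u ∧ f.edge '' S.inp u' = T.inp u

/-- Inner face maps `T/e → T`: the inner edge `e`, which is the output of `v` and an input of
`w`, is contracted, and `v`, `w` are merged into one vertex. -/
def IsInnerFace {S T : DTree} (f : S ⟶ T) : Prop :=
  ∃ v w : T.V, T.out v ∈ T.inp w ∧
    Function.Injective f.edge ∧ Set.range f.edge = {T.out v}ᶜ ∧
    (∃ u', f.edge (S.out u') = T.out w ∧
      f.edge '' S.inp u' = (T.inp w \ {T.out v}) ∪ T.inp v) ∧
    ∀ u, u ≠ v → u ≠ w → ∃ u', VertexOver f u' u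

/-- Outer face maps which chop off a vertex `v` all of whose inputs are leaves. (If `v` is the
only vertex, this is the inclusion of the root edge into a corolla.) -/
def IsTopFace {S T : DTree} (f : S ⟶ T) : Prop :=
  ∃ v : T.V, (∀ e ∈ T.inp v, T.IsLeaf e) ∧
    Function.Injective f.edge ∧ Set.range f.edge = (T.inp v)ᶜ ∧
    (∀ u', f.edge (S.out u') ≠ T.out v) ∧
    ∀ u, u ≠ v → ∃ u', VertexOver f u' u

/-- Outer face maps which chop off the root vertex `r`, where all inputs of `r` except possibly
`e` are leaves; `e` becomes the new root. (If `r` is the only vertex, this is the inclusion of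
the leaf `e` into a corolla.) -/
def IsRootFace {S T : DTree} (f : S ⟶ T) : Prop :=
  ∃ (r : T.V) (e : T.E), T.out r = T.root ∧ e ∈ T.inp r ∧
    (∀ e' ∈ T.inp r, e' ≠ e → T.IsLeaf e') ∧
    Function.Injective f.edge ∧ Set.range f.edge = (insert T.root (T.inp r \ {e}))ᶜ ∧
    ∀ u, u ≠ r → ∃ u', VertexOver f u' u

/-- Isomorphisms and face maps. -/
def isoOrFace : MorphismProperty DTree := fun _ _ f =>
  IsIso f ∨ IsInnerFace f ∨ IsTopFace f ∨ IsRootFace f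

/-- The corolla with set of leaves `J`. -/
def corolla (J : Type) [Finite J] : DTree where
  E := Option J
  V := Unit
  inp _ := Set.range some
  out _ := none
  root := none
  out_injective _ _ _ := rfl
  inp_unique _ _ := rfl
  root_notMem _ := by simp
  reach e := by
    cases e with
    | none => exact .refl
    | some j => exact .single ⟨(), ⟨j, rfl⟩, rfl⟩

end DTree

/-- The wide subcategory `Ω_inj` of `Ω` generated by isomorphisms and face maps. -/
abbrev OmegaInj : Type 1 := WideSubcategory DTree.isoOrFace.multiplicativeClosure

/-- A tree as an object of `Ω_inj`. -/
def DTree.inj (T : DTree) : OmegaInj := ⟨T⟩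

/-- Semi-dendroidal spaces. -/
abbrev SemiDendroidalSpace : Type 2 := OmegaInjᵒᵖ ⥤ TopCat.{1}

/-! ## Weak homotopy equivalences and the Segal condition -/

section Weak

universe u v

variable {X : Type u} {Y : Type v} [TopologicalSpace X] [TopologicalSpace Y]

/-- The map induced by `f` on sets of path components. -/
def piZeroMap (f : C(X, Y)) : ZerothHomotopy X → ZerothHomotopy Y :=
  Quotient.map f fun _ _ h => h.map f.continuous

/-- The map induced by `f` on `n`-th homotopy groups. -/
def piMap (n : ℕ) (f : C(X, Y)) (x : X) :
    HomotopyGroup.Pi n X x → HomotopyGroup.Pi n Y (f x) :=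
  Quotient.map
    (fun p : GenLoop (Fin n) X x =>
      (⟨f.comp p.1, fun y hy => congrArg f (p.2 y hy)⟩ : GenLoop (Fin n) Y (f x)))
    fun _ _ h => h.map fun H => H.compContinuousMap f

/-- Weak homotopy equivalences. -/
def IsWeakHomotopyEquiv (f : X → Y) : Prop :=
  ∃ hf : Continuous f, Function.Bijective (piZeroMap ⟨f, hf⟩) ∧
    ∀ (n : ℕ) (x : X), 1 ≤ n → Function.Bijective (piMap n ⟨f, hf⟩ x)

end Weak

/-- `ι` is the inclusion into `T` of the corolla `C_v` at the vertex `v`. -/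
def IsCorollaInclusion (T : DTree) (v : T.V)
    (ι : (DTree.corolla (T.inp v)).inj ⟶ T.inj) : Prop :=
  ι.hom.edge none = T.out v ∧ ∀ e : T.inp v, ι.hom.edge (some e) = e.1

/-- The Segal condition: `X_η` is a point and, for `T ≠ η`, the map
`X_T → ∏_v X_{C_v}` induced by the corolla inclusions is a weak homotopy equivalence. -/
def SegalCondition (X : SemiDendroidalSpace) : Prop :=
  (∀ T : DTree, T.IsTrivial → Nonempty (Unique (X.obj (.op T.inj)))) ∧
  ∀ T : DTree, ¬ T.IsTrivial →
    ∃ ι : ∀ v : T.V, (DTree.corolla (T.inp v)).inj ⟶ T.inj,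
      (∀ v, IsCorollaInclusion T v (ι v)) ∧
      IsWeakHomotopyEquiv
        (fun (x : X.obj (.op T.inj)) (v : T.V) => X.map (ι v).op x)

/-! ## Operads with shifts -/

/-- The colours `1` and `2`. -/
inductive Colour
  | one
  | two

/-- The order `1 ≤ 2`. -/
instance : LE Colour := ⟨fun a b => a = .two → b = .two⟩

/-- A family of maps `O(l; 1) → O(l'; 1)` for `l ≤ l'`. -/
def ShiftData (O : OperadData Colour) : Type 1 :=
  ∀ {I : Type} [Finite I] {c c' : I → Colour}, (∀ i, c i ≤ c' i) → O.Op c .one → O.Op c' .one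

/-- `(O, s)` is an operad with shifts. -/
structure IsOperadWithShifts (O : OperadData Colour) (s : ShiftData O) : Prop where
  isOperad : O.IsOperad
  point_of_eq : ∀ {I : Type} [Finite I] (c : I → Colour),
    Nat.card I = 1 → (∀ i, c i = .two) → Nonempty (Unique (O.Op c .two))
  empty_of_ne : ∀ {I : Type} [Finite I] (c : I → Colour),
    ¬ (Nat.card I = 1 ∧ ∀ i, c i = .two) → IsEmpty (O.Op c .two)
  weakEquiv : ∀ {I : Type} [Finite I] {c c' : I → Colour} (h : ∀ i, c i ≤ c' i),
    IsWeakHomotopyEquiv (s h)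
  shift_refl : ∀ {I : Type} [Finite I] {c : I → Colour} (h : ∀ i, c i ≤ c i)
    (x : O.Op c .one), s h x = x
  shift_trans : ∀ {I : Type} [Finite I] {c c' c'' : I → Colour} (h : ∀ i, c i ≤ c' i)
    (h' : ∀ i, c' i ≤ c'' i) (h'' : ∀ i, c i ≤ c'' i) (x : O.Op c .one),
    s h' (s h x) = s h'' x
  shift_circ : ∀ {I J : Type} [Finite I] [Finite J] (i : I) {c₀ c₁ : I → Colour}
    {c₂ c₃ : J → Colour} (h : ∀ k, c₀ k ≤ c₁ k) (h' : ∀ j, c₂ j ≤ c₃ j)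
    (hs : ∀ k, substProfile c₀ i c₂ k ≤ substProfile c₁ i c₃ k)
    (h₀ : c₀ i = .one) (h₁ : c₁ i = .one) (x : O.Op c₀ .one) (y : O.Op c₂ .one),
    O.circ i h₁ (s h x) (s h' y) = s hs (O.circ i h₀ x y)
  shift_reindex : ∀ {I J : Type} [Finite I] [Finite J] (e : I ≃ J) {c c' : I → Colour}
    {d d' : J → Colour} (h : ∀ i, c i ≤ c' i) (k : ∀ j, d j ≤ d' j)
    (hd : ∀ i, d (e i) = c i) (hd' : ∀ i, d' (e i) = c' i) (x : O.Op c .one),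
    O.reindex e hd' (s h x) = s k (O.reindex e hd x)

/-! ## The associated semi-dendroidal space -/

/-- The dendroidal nerve `N_d(O)_T`: the space of maps of operads `Ω(T) → O`, a coproduct over
the possible maps on colours. -/
def DendroidalNerve {C : Type} (O : OperadData C) (T : DTree) : Type 1 :=
  Σ f : T.E → C, OperadMap T.operad O f

instance {C : Type} (O : OperadData C) (T : DTree) :
    TopologicalSpace (DendroidalNerve O T) :=
  inferInstanceAs (TopologicalSpace (Σ f : T.E → C, OperadMap T.operad O f))

/-- The subspace `X_T` of the nerve (for `T ≠ η`) of all maps which send the leaves to `2` and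
the root and all inner edges to `1`. -/
def ShiftSpace (O : OperadData Colour) (T : DTree) : Type 1 :=
  {x : DendroidalNerve O T // (∀ e, T.IsLeaf e → x.1 e = .two) ∧ x.1 T.root = .one ∧
    ∀ e, ¬ T.IsLeaf e → e ≠ T.root → x.1 e = .one}

instance (O : OperadData Colour) (T : DTree) : TopologicalSpace (ShiftSpace O T) :=
  inferInstanceAs (TopologicalSpace {x : DendroidalNerve O T // _})

/-- `y ∈ N_d(O)_S` is obtained from `x ∈ N_d(O)_T` by restricting along `α : S → T` and then
shifting at the leaves of `S`: leaves of `S` get the colour `2`, other edges keep their colour,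
and at each vertex (with output of colour `1`) the shift map is applied. -/
def IsShiftedRestriction {O : OperadData Colour} (s : ShiftData O) {S T : DTree}
    (α : S ⟶ T) (x : DendroidalNerve O T) (y : DendroidalNerve O S) : Prop :=
  (∀ e, S.IsLeaf e → y.1 e = .two) ∧
  (∀ e, ¬ S.IsLeaf e → y.1 e = x.1 (α.edge e)) ∧
  ∀ (v : S.V) (hx : x.1 (α.edge (S.out v)) = .one) (hy : y.1 (S.out v) = .one)
    (hle : ∀ e : S.inp v, x.1 (α.edge e.1) ≤ y.1 e.1),
    O.recolor hy (y.2.toFun (S.vertexOp v)) =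
      s hle (O.recolor hx (x.2.toFun (α.map.toFun (S.vertexOp v))))

/-- An identification of `X` with the semi-dendroidal space associated with `(O, s)`: its value
at `η` is a point, its value at `T ≠ η` is `ShiftSpace O T`, and `α : S → T` in `Ω_inj` acts by
restriction followed by the shift at the leaves. -/
structure AssociatedTo (O : OperadData Colour) (s : ShiftData O) (X : SemiDendroidalSpace) where
  point : ∀ T : DTree, T.IsTrivial → Nonempty (Unique (X.obj (.op T.inj)))
  homeo : ∀ T : DTree, ¬ T.IsTrivial → X.obj (.op T.inj) ≃ₜ ShiftSpace O T
  map : ∀ {S T : DTree} (α : S.inj ⟶ T.inj) (hS : ¬ S.IsTrivial) (hT : ¬ T.IsTrivial)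
    (x : X.obj (.op T.inj)),
    IsShiftedRestriction s α.hom (homeo T hT x).1 (homeo S hS (X.map α.op x)).1

/-! ## The operad of points and little disks -/

/-- Euclidean space `ℝⁿ`. -/
abbrev Euc (n : ℕ) : Type := EuclideanSpace ℝ (Fin n)

/-- The open unit disk. -/
def unitDisk (n : ℕ) : Set (Euc n) := Metric.ball 0 1

/-- Colour `1`: an affine map `t ↦ r t + c`, recorded as `(r, c)`. Colour `2`: a point. -/
def Item (n : ℕ) : Colour → Type
  | .one => ℝ × Euc n
  | .two => Euc n

instance (n : ℕ) : (k : Colour) → TopologicalSpace (Item n k)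
  | .one => inferInstanceAs (TopologicalSpace (ℝ × Euc n))
  | .two => inferInstanceAs (TopologicalSpace (Euc n))

/-- The affine map `t ↦ r t + c`. -/
def affineMap {n : ℕ} (a : ℝ × Euc n) (t : Euc n) : Euc n := a.1 • t + a.2

/-- The image of the open unit disk. -/
def diskOf {n : ℕ} (a : ℝ × Euc n) : Set (Euc n) := affineMap a '' unitDisk n

/-- `(r, c)` is an embedding of the unit disk into itself, resp. `d` is a point of the disk. -/
def Item.Valid {n : ℕ} : {k : Colour} → Item n k → Prop
  | .one, (a : ℝ × Euc n) => 0 < a.1 ∧ diskOf a ⊆ unitDisk n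
  | .two, (d : Euc n) => d ∈ unitDisk n

/-- Disks are disjoint, points are distinct, and points avoid closures of disks. -/
def Item.Apart {n : ℕ} : {k k' : Colour} → Item n k → Item n k' → Prop
  | .one, .one, (a : ℝ × Euc n), (b : ℝ × Euc n) => Disjoint (diskOf a) (diskOf b)
  | .one, .two, (a : ℝ × Euc n), (d : Euc n) => d ∉ closure (diskOf a)
  | .two, .one, (d : Euc n), (a : ℝ × Euc n) => d ∉ closure (diskOf a)
  | .two, .two, (d : Euc n), (d' : Euc n) => d ≠ d'

/-- The centre of a disk, resp. the point itself. -/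
def Item.centre {n : ℕ} : {k : Colour} → Item n k → Euc n
  | .one, (a : ℝ × Euc n) => affineMap a 0
  | .two, (d : Euc n) => d

/-- Replace the colour by an equal one. -/
def Item.recolor {n : ℕ} {k k' : Colour} (h : k = k') (x : Item n k) : Item n k' := h ▸ x

/-- Apply the affine map `a` to a disk (by composition) or to a point. -/
def Item.act {n : ℕ} (a : ℝ × Euc n) : {k : Colour} → Item n k → Item n k
  | .one, (b : ℝ × Euc n) => ((a.1 * b.1, affineMap a b.2) : ℝ × Euc n)
  | .two, (d : Euc n) => affineMap a d

/-- Replace a disk by its centre whenever the colour changes. -/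
def Item.shift {n : ℕ} : {k k' : Colour} → k ≤ k' → Item n k → Item n k'
  | .one, .one, _, (a : ℝ × Euc n) => a
  | .one, .two, _, (a : ℝ × Euc n) => affineMap a 0
  | .two, .two, _, (d : Euc n) => d
  | .two, .one, h, _ => nomatch h rfl

/-- Configurations of disks and points of type `c`: the space `O(c; 1)`. -/
def DiskConfig (n : ℕ) {I : Type} (c : I → Colour) : Type :=
  {x : (i : I) → Item n (c i) // (∀ i, (x i).Valid) ∧ ∀ i j, i ≠ j → (x i).Apart (x j)}

instance (n : ℕ) {I : Type} (c : I → Colour) : TopologicalSpace (DiskConfig n c) :=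
  inferInstanceAs (TopologicalSpace {x : (i : I) → Item n (c i) // _})

theorem diskOf_eq_ball {n : ℕ} {a : ℝ × Euc n} (ha : 0 < a.1) :
    diskOf a = Metric.ball a.2 a.1 := by
  ext y
  simp only [diskOf, affineMap, unitDisk, Set.mem_image, mem_ball_iff_norm, sub_zero]
  constructor
  · rintro ⟨t, ht, rfl⟩
    rw [add_sub_cancel_right, norm_smul, Real.norm_of_nonneg ha.le]
    nlinarith
  · intro h
    refine ⟨a.1⁻¹ • (y - a.2), ?_, ?_⟩
    · rw [norm_smul, norm_inv, Real.norm_of_nonneg ha.le, inv_mul_lt_iff₀ ha]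
      simpa using h
    · rw [smul_inv_smul₀ ha.ne']
      abel

theorem affineMap_injective {n : ℕ} {a : ℝ × Euc n} (ha : 0 < a.1) :
    Function.Injective (affineMap a) := fun x y h => by
  have h' : a.1 • x = a.1 • y := add_right_cancel h
  exact smul_right_injective _ ha.ne' h'

theorem affineMap_comp {n : ℕ} (a b : ℝ × Euc n) (t : Euc n) :
    affineMap ((a.1 * b.1, affineMap a b.2) : ℝ × Euc n) t = affineMap a (affineMap b t) := by
  simp only [affineMap, smul_add, mul_smul, add_assoc]

theorem diskOf_act {n : ℕ} (a b : ℝ × Euc n) :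
    diskOf ((a.1 * b.1, affineMap a b.2) : ℝ × Euc n) = affineMap a '' diskOf b := by
  simp only [diskOf, Set.image_image, affineMap_comp]

theorem continuous_affineMap {n : ℕ} (a : ℝ × Euc n) : Continuous (affineMap a) := by
  unfold affineMap
  fun_prop

theorem closure_image_affineMap {n : ℕ} {a : ℝ × Euc n} (ha : 0 < a.1) (s : Set (Euc n)) :
    closure (affineMap a '' s) = affineMap a '' closure s := by
  have h : affineMap a = (Homeomorph.smulOfNeZero a.1 ha.ne').trans (Homeomorph.addRight a.2) := by
    funext t
    rfl
  rw [h, Homeomorph.image_closure]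

theorem isOpen_diskOf {n : ℕ} {a : ℝ × Euc n} (ha : 0 < a.1) : IsOpen (diskOf a) := by
  rw [diskOf_eq_ball ha]
  exact Metric.isOpen_ball

theorem centre_mem_diskOf {n : ℕ} (a : ℝ × Euc n) : affineMap a 0 ∈ diskOf a :=
  ⟨0, by simp [unitDisk], rfl⟩

theorem Item.Apart.symm {n : ℕ} {k k' : Colour} {x : Item n k} {y : Item n k'}
    (h : x.Apart y) : y.Apart x := by
  cases k <;> cases k'
  · exact Disjoint.symm h
  · exact h
  · exact h
  · exact Ne.symm h

theorem Item.Valid.act {n : ℕ} {a : ℝ × Euc n} (ha : 0 < a.1) (ha' : diskOf a ⊆ unitDisk n)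
    {k : Colour} {x : Item n k} (hx : x.Valid) : (x.act a).Valid := by
  cases k
  · refine ⟨mul_pos ha hx.1, ?_⟩
    exact (diskOf_act a x).trans_subset ((Set.image_mono hx.2).trans ha')
  · exact ha' ⟨x, hx, rfl⟩

theorem disjoint_diskOf_act {n : ℕ} {a : ℝ × Euc n} (ha : 0 < a.1) (b b' : ℝ × Euc n)
    (h : Disjoint (diskOf b) (diskOf b')) :
    Disjoint (diskOf ((a.1 * b.1, affineMap a b.2) : ℝ × Euc n))
      (diskOf ((a.1 * b'.1, affineMap a b'.2) : ℝ × Euc n)) := by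
  rw [diskOf_act, diskOf_act]
  exact (Set.disjoint_image_iff (affineMap_injective ha)).2 h

theorem notMem_closure_diskOf_act {n : ℕ} {a : ℝ × Euc n} (ha : 0 < a.1) (b : ℝ × Euc n)
    (d : Euc n) (h : d ∉ closure (diskOf b)) :
    affineMap a d ∉ closure (diskOf ((a.1 * b.1, affineMap a b.2) : ℝ × Euc n)) := by
  rw [diskOf_act, closure_image_affineMap ha]
  rintro ⟨d', hd', h'⟩
  exact h (affineMap_injective ha h' ▸ hd')

theorem Item.Apart.act {n : ℕ} {a : ℝ × Euc n} (ha : 0 < a.1)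
    {k k' : Colour} {x : Item n k} {y : Item n k'} (h : x.Apart y) :
    (x.act a).Apart (y.act a) := by
  cases k <;> cases k'
  · exact disjoint_diskOf_act ha x y h
  · exact notMem_closure_diskOf_act ha x y h
  · exact notMem_closure_diskOf_act ha y x h
  · exact fun h' => h (affineMap_injective ha h')

theorem diskOf_act_subset {n : ℕ} (a b : ℝ × Euc n) (hb : diskOf b ⊆ unitDisk n) :
    diskOf ((a.1 * b.1, affineMap a b.2) : ℝ × Euc n) ⊆ diskOf a := by
  rw [diskOf_act]
  exact Set.image_mono hb

theorem notMem_closure_diskOf {n : ℕ} {a b : ℝ × Euc n} (ha : 0 < a.1)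
    (h : Disjoint (diskOf b) (diskOf a)) {t : Euc n} (ht : t ∈ diskOf a) :
    t ∉ closure (diskOf b) := fun hm =>
  Set.disjoint_left.1 (Disjoint.closure_left h (isOpen_diskOf ha)) hm ht

theorem ne_of_notMem_closure {n : ℕ} {a : ℝ × Euc n} {d t : Euc n}
    (h : d ∉ closure (diskOf a)) (ht : t ∈ diskOf a) : d ≠ t := by
  rintro rfl
  exact h (subset_closure ht)

/-- An item apart from the disk of `a` is apart from everything inside this disk. -/
theorem Item.Apart.act_right {n : ℕ} {a : Item n .one} {k k' : Colour} {x : Item n k}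
    {y : Item n k'} (ha : a.Valid) (hy : y.Valid) (h : x.Apart a) :
    x.Apart (y.act a) := by
  cases k <;> cases k'
  · exact Disjoint.mono_right (diskOf_act_subset a y hy.2) h
  · exact notMem_closure_diskOf ha.1 h ⟨y, hy, rfl⟩
  · exact fun hm => h (closure_mono (diskOf_act_subset a y hy.2) hm)
  · exact ne_of_notMem_closure h ⟨y, hy, rfl⟩

theorem Item.Valid.shift {n : ℕ} {k k' : Colour} (hk : k ≤ k') {x : Item n k} (hx : x.Valid) :
    (x.shift hk).Valid := by
  cases k <;> cases k'
  · exact hx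
  · exact hx.2 (centre_mem_diskOf x)
  · exact nomatch hk rfl
  · exact hx

theorem Item.Apart.shift_left {n : ℕ} {k k' l : Colour} (hk : k ≤ k') {x : Item n k}
    {y : Item n l} (hx : x.Valid) (h : x.Apart y) : (x.shift hk).Apart y := by
  cases k <;> cases k'
  · exact h
  · cases l
    · exact notMem_closure_diskOf hx.1 (Disjoint.symm h) (centre_mem_diskOf x)
    · exact (ne_of_notMem_closure h (centre_mem_diskOf x)).symm
  · exact nomatch hk rfl
  · exact h

theorem Item.Valid.recolor {n : ℕ} {k k' : Colour} (h : k = k') {x : Item n k} (hx : x.Valid) :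
    (x.recolor h).Valid := by
  subst h
  exact hx

theorem Item.Apart.recolor {n : ℕ} {k k' l l' : Colour} (h : k = k') (h' : l = l')
    {x : Item n k} {y : Item n l} (hx : x.Apart y) : (x.recolor h).Apart (y.recolor h') := by
  subst h
  subst h'
  exact hx

namespace DiskConfig

variable {n : ℕ} {I J : Type}

/-- The configuration consisting of the whole unit disk. -/
def one (n : ℕ) : DiskConfig n (fun _ : Unit => Colour.one) :=
  ⟨fun _ => ((1, 0) : ℝ × Euc n), by
    refine ⟨fun _ => ⟨one_pos, ?_⟩, fun i j h => (h rfl).elim⟩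
    rw [diskOf_eq_ball one_pos]
    exact subset_rfl⟩

/-- Relabelling. -/
def reindex (e : I ≃ J) {c : I → Colour} {c' : J → Colour} (h : ∀ i, c' (e i) = c i)
    (x : DiskConfig n c) : DiskConfig n c' :=
  have h' : ∀ j, c (e.symm j) = c' j := fun j => by rw [← h, e.apply_symm_apply]
  ⟨fun j => (x.1 (e.symm j)).recolor (h' j),
    fun j => (x.2.1 (e.symm j)).recolor (h' j),
    fun j j' hj => (x.2.2 _ _ (e.symm.injective.ne hj)).recolor (h' j) (h' j')⟩

/-- The underlying family of `x ∘_i y` for a disk `x_i`: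
`x_1, …, x_{i-1}, a_i y_1, …, a_i y_q, x_{i+1}, …, x_p`. -/
def circ (i : I) {c : I → Colour} {c' : J → Colour} (hi : c i = .one)
    (x : DiskConfig n c) (y : DiskConfig n c') : DiskConfig n (substProfile c i c') :=
  let a : Item n .one := (x.1 i).recolor hi
  have ha : a.Valid := (x.2.1 i).recolor hi
  have key : ∀ (k : I) (j : J), k ≠ i → (x.1 k).Apart ((y.1 j).act a) := fun k j hk =>
    Item.Apart.act_right ha (y.2.1 j) ((x.2.2 k i hk).recolor rfl hi)
  ⟨fun k => match k with
    | Sum.inl k => x.1 k.1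
    | Sum.inr j => (y.1 j).act a,
   by
    constructor
    · rintro (k | j)
      · exact x.2.1 k.1
      · exact (y.2.1 j).act ha.1 ha.2
    · rintro (k | j) (k' | j') h
      · exact x.2.2 k.1 k'.1 (fun e => h (congrArg Sum.inl (Subtype.ext e)))
      · exact key k.1 j' k.2
      · exact (key k'.1 j k'.2).symm
      · exact (y.2.2 j j' (fun e => h (congrArg Sum.inr e))).act ha.1⟩

/-- Composition with the identity of colour `2` at a point `x_i`: nothing changes but the name
of the index `i`. -/
def circPoint (i : I) {c : I → Colour} {c' : J → Colour} (hi : c i = .two)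
    (hJ : Nat.card J = 1 ∧ ∀ j, c' j = .two)
    (x : DiskConfig n c) : DiskConfig n (substProfile c i c') :=
  have hij : ∀ j, c i = c' j := fun j => hi.trans (hJ.2 j).symm
  ⟨fun k => match k with
    | Sum.inl k => x.1 k.1
    | Sum.inr j => (x.1 i).recolor (hij j),
   by
    constructor
    · rintro (k | j)
      · exact x.2.1 k.1
      · exact (x.2.1 i).recolor (hij j)
    · rintro (k | j) (k' | j') h
      · exact x.2.2 k.1 k'.1 (fun e => h (congrArg Sum.inl (Subtype.ext e)))
      · exact (x.2.2 k.1 i k.2).recolor rfl (hij j')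
      · exact (x.2.2 i k'.1 k'.2.symm).recolor (hij j) rfl
      · have : Subsingleton J := (Nat.card_eq_one_iff_unique.1 hJ.1).1
        exact (h (congrArg Sum.inr (Subsingleton.elim j j'))).elim⟩

/-- The shift map: disks are replaced by their centres where the colour changes. -/
def shift {c c' : I → Colour} (h : ∀ i, c i ≤ c' i) (x : DiskConfig n c) : DiskConfig n c' :=
  ⟨fun i => (x.1 i).shift (h i),
    fun i => (x.2.1 i).shift (h i),
    fun i j hij =>
      have h1 := (x.2.2 i j hij).shift_left (h i) (x.2.1 i)
      (h1.symm.shift_left (h j) (x.2.1 j)).symm⟩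

end DiskConfig

/-- The spaces of operations: `O(l; 1)` is the space of configurations, `O(l; 2)` is a point
if `l = 2` and empty otherwise. -/
def PointsDisksOp (n : ℕ) {I : Type} (c : I → Colour) : Colour → Type
  | .one => DiskConfig n c
  | .two => PLift (Nat.card I = 1 ∧ ∀ i, c i = .two)

theorem card_subst {I J : Type} (i : I) (hI : Nat.card I = 1) (hJ : Nat.card J = 1) :
    Nat.card ({k : I // k ≠ i} ⊕ J) = 1 := by
  have : Subsingleton I := (Nat.card_eq_one_iff_unique.1 hI).1
  have : IsEmpty {k : I // k ≠ i} := ⟨fun k => k.2 (Subsingleton.elim _ _)⟩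
  rw [Nat.card_congr (Equiv.emptySum _ J), hJ]

/-- The operad of points and little disks in dimension `n`. -/
def pointsDisks (n : ℕ) : OperadData Colour where
  Op c d := PointsDisksOp n c d
  top c d := match d with
    | .one => inferInstanceAs (TopologicalSpace (DiskConfig n c))
    | .two => ⊥
  one a := match a with
    | .one => DiskConfig.one n
    | .two => ⟨by simp, fun _ => rfl⟩
  reindex e c c' d h x := match d, x with
    | .one, x => DiskConfig.reindex e h x
    | .two, x => ⟨by rw [← Nat.card_congr e]; exact x.down.1,
        fun j => by rw [← e.apply_symm_apply j, h]; exact x.down.2 _⟩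
  circ i c c' a d hi x y := match d, a, hi, x, y with
    | .one, .one, hi, x, y => DiskConfig.circ i hi x y
    | .one, .two, hi, x, y => DiskConfig.circPoint i hi y.down x
    | .two, .two, _, x, y => ⟨card_subst i x.down.1 y.down.1, by
        rintro (k | j)
        exacts [x.down.2 k.1, y.down.2 j]⟩
    | .two, .one, hi, x, _ => nomatch hi.symm.trans (x.down.2 i)

/-- The shift maps of the operad of points and little disks. -/
def pointsDisksShift (n : ℕ) : ShiftData (pointsDisks n) :=
  fun h x => DiskConfig.shift h x

/-- The ordered configuration space of `k` points in the open unit `n`-disk. -/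
def OrderedConfig (n k : ℕ) : Type :=
  {p : Fin k → Euc n // (∀ i, p i ∈ unitDisk n) ∧ Function.Injective p}

instance (n k : ℕ) : TopologicalSpace (OrderedConfig n k) :=
  inferInstanceAs (TopologicalSpace {p : Fin k → Euc n // _})

theorem corolla_not_trivial (J : Type) [Finite J] : ¬ (DTree.corolla J).IsTrivial :=
  fun h => h.elim ()

/-- The `i`-th point of an element of the space `X_{C_k}` associated with the operad of points
and little disks, that is, of a configuration attached to the only vertex of `C_k`. -/
def corollaPoint {n k : ℕ} (x : ShiftSpace (pointsDisks n) (DTree.corolla (Fin k)))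
    (i : Fin k) : Euc n :=
  have hroot : x.1.1 none = .one := x.2.2.1
  let z : DiskConfig n (fun e : (DTree.corolla (Fin k)).inp () => x.1.1 e.1) :=
    (pointsDisks n).recolor hroot (x.1.2.toFun ((DTree.corolla (Fin k)).vertexOp ()))
  (z.1 ⟨some i, ⟨i, rfl⟩⟩).centre

/-! Every item is encoded by its radius and centre, a point having radius `0`. An operation then
becomes a family in `ℝ × ℝⁿ`; `opCode` is injective and inducing, composition becomes multiplication
`affMul` of affine maps, and a shift becomes the projection `codeShift`, which kills radii. The
axioms of operads and shifts reduce to identities between entries.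

A shift map forgets some radii. Near a given configuration `x₀` it has a continuous section defined
on the whole target: a point that has to become a disk gets the radius it had in `x₀`, times a
positive continuous factor `s y` with value `1` at the image of `x₀`. The factor is a minimum of
quotients of gaps, so disks do not meet or leave the unit disk. Interpolating radii linearly with
fixed centres stays inside the configurations and deforms section after shift into the identity,
relative to `x₀` (`hasPointedSections_pointsDisksShift`). This property, `HasPointedSections`,
yields homotopy equivalences and weak equivalences, and passes to products and along homeomorphisms.

For the Segal condition, `Ω(T)` is free on the vertices of `T`: an operad map with the prescribed
colours is the same as one configuration per vertex, as a homeomorphism (`leafMapHomeo`). Uniqueness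
is induction on subtrees (`operadMap_ext`). For existence, each edge gets a position relative to the
root by multiplying affine maps along its path, and relative positions are quotients of these. Under
this identification the Segal map is a product of shift maps, hence a weak equivalence.

It remains that a corolla inclusion lies in `Ω_inj`, that is, factors into outer faces and an
isomorphism (`corollaHom_mem`). This is an induction on the number of vertices, removing a top
vertex or the root vertex. -/

/-! ## Configurations as families of pairs (radius, centre) -/

/-- Composition of the affine maps `t ↦ r t + c`. -/
def affMul {n : ℕ} (a b : ℝ × Euc n) : ℝ × Euc n := (a.1 * b.1, affineMap a b.2)

/-- The inverse of the affine map `t ↦ r t + c`. -/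
noncomputable def affInv {n : ℕ} (a : ℝ × Euc n) : ℝ × Euc n := (a.1⁻¹, -(a.1⁻¹ • a.2))

section affMul

variable {n : ℕ}

theorem affMul_assoc (a b c : ℝ × Euc n) : affMul (affMul a b) c = affMul a (affMul b c) := by
  simp only [affMul, affineMap, smul_add, mul_smul, add_assoc, mul_assoc]

@[simp]
theorem affMul_one (a : ℝ × Euc n) : affMul a (1, 0) = a := by
  simp [affMul, affineMap]

@[simp]
theorem one_affMul (a : ℝ × Euc n) : affMul (1, 0) a = a := by
  simp [affMul, affineMap]

theorem affInv_affMul {a : ℝ × Euc n} (ha : a.1 ≠ 0) : affMul (affInv a) a = (1, 0) := by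
  simp [affMul, affineMap, affInv, ha]

theorem affMul_affInv {a : ℝ × Euc n} (ha : a.1 ≠ 0) : affMul a (affInv a) = (1, 0) := by
  simp [affMul, affineMap, affInv, ha]

theorem continuous_affMul : Continuous fun p : (ℝ × Euc n) × (ℝ × Euc n) => affMul p.1 p.2 := by
  unfold affMul affineMap
  fun_prop

end affMul

/-- The radius and the centre of an item, where points have radius `0`. -/
def Item.code {n : ℕ} : {k : Colour} → Item n k → ℝ × Euc n
  | .one, (a : ℝ × Euc n) => a
  | .two, (d : Euc n) => (0, d)

/-- The item of colour `k` with the given radius and centre. -/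
def Item.ofCode {n : ℕ} : (k : Colour) → ℝ × Euc n → Item n k
  | .one, a => a
  | .two, a => a.2

/-- Forget the radius if the colour is that of points. -/
def codeShift {n : ℕ} : Colour → ℝ × Euc n → ℝ × Euc n
  | .one, a => a
  | .two, a => (0, a.2)

section code

variable {n : ℕ}

theorem Item.isInducing_code (k : Colour) : IsInducing (Item.code : Item n k → ℝ × Euc n) := by
  cases k
  · exact IsInducing.id
  · exact (isEmbedding_prodMkRight (0 : ℝ)).isInducing

theorem Item.code_injective (k : Colour) :
    Function.Injective (Item.code : Item n k → ℝ × Euc n) := by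
  cases k
  · exact fun _ _ h => h
  · exact fun _ _ h => congrArg Prod.snd h

@[simp]
theorem Item.code_recolor {k k' : Colour} (h : k = k') (x : Item n k) :
    (x.recolor h).code = x.code := by
  subst h
  rfl

@[simp]
theorem Item.code_act (a : ℝ × Euc n) {k : Colour} (x : Item n k) :
    (x.act a).code = affMul a x.code := by
  cases k
  · rfl
  · exact Prod.ext (mul_zero _).symm rfl

@[simp]
theorem Item.code_ofCode (k : Colour) (a : ℝ × Euc n) :
    (Item.ofCode k a).code = codeShift k a := by
  cases k <;> rfl

@[simp]
theorem Item.codeShift_code {k : Colour} (x : Item n k) : codeShift k x.code = x.code := by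
  cases k <;> rfl

theorem Item.centre_eq {k : Colour} (x : Item n k) : x.centre = x.code.2 := by
  cases k
  · simp [Item.centre, Item.code, affineMap]
  · rfl

theorem Item.code_shift {k k' : Colour} (h : k ≤ k') (x : Item n k) :
    (x.shift h).code = codeShift k' x.code := by
  cases k <;> cases k'
  · rfl
  · exact Prod.ext rfl (by simp [Item.shift, Item.code, affineMap, codeShift])
  · exact nomatch h rfl
  · rfl

@[simp]
theorem codeShift_snd (k : Colour) (a : ℝ × Euc n) : (codeShift k a).2 = a.2 := by
  cases k <;> rfl

/-- A later colour forgets at least as much as an earlier one. This is the functoriality of shifts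
and, later, of the restriction maps of the semi-dendroidal space. -/
theorem codeShift_codeShift {k k' : Colour} (h : k ≤ k') (a : ℝ × Euc n) :
    codeShift k' (codeShift k a) = codeShift k' a := by
  cases k <;> cases k'
  · rfl
  · rfl
  · exact nomatch h rfl
  · rfl

/-- Radii multiply under composition, so radius `0` persists: an affine map carries centres to
centres. -/
theorem affMul_codeShift (k : Colour) (a b : ℝ × Euc n) :
    affMul a (codeShift k b) = codeShift k (affMul a b) := by
  cases k
  · rfl
  · exact Prod.ext (mul_zero _) rfl

theorem continuous_codeShift (k : Colour) :
    Continuous (codeShift k : ℝ × Euc n → ℝ × Euc n) := by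
  cases k
  · exact continuous_id
  · exact continuous_const.prodMk continuous_snd

/-- The radii and centres of an operation; the value is `(1, 0)` for operations of output
colour `2`. -/
def opCode {I : Type} [Finite I] {c : I → Colour} :
    {d : Colour} → (pointsDisks n).Op c d → I → ℝ × Euc n
  | .one, (x : DiskConfig n c), i => (x.1 i).code
  | .two, _, _ => (1, 0)

instance {I : Type} [Finite I] (c : I → Colour) : Subsingleton ((pointsDisks n).Op c .two) :=
  inferInstanceAs (Subsingleton (PLift _))

/-- Continuity into a space of operations can thus be tested on radii and centres. For output colour
`2` the space has at most one element. -/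
theorem isInducing_opCode {I : Type} [Finite I] (c : I → Colour) (d : Colour) :
    IsInducing (opCode : (pointsDisks n).Op c d → I → ℝ × Euc n) := by
  cases d
  · exact (IsInducing.piMap fun i => Item.isInducing_code (n := n) (c i)).comp
      IsInducing.subtypeVal
  · exact ⟨Subsingleton.elim _ _⟩

theorem continuous_opCode {I : Type} [Finite I] (c : I → Colour) (d : Colour) :
    Continuous (opCode : (pointsDisks n).Op c d → I → ℝ × Euc n) :=
  (isInducing_opCode c d).continuous

theorem opCode_injective {I : Type} [Finite I] (c : I → Colour) (d : Colour) :
    Function.Injective (opCode : (pointsDisks n).Op c d → I → ℝ × Euc n) := by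
  cases d
  · exact fun x y h => Subtype.ext (funext fun i => Item.code_injective _ (congrFun h i))
  · exact Function.injective_of_subsingleton _

theorem opCode_ext {I : Type} [Finite I] {c : I → Colour} {d : Colour}
    {x y : (pointsDisks n).Op c d} (h : ∀ i, opCode x i = opCode y i) : x = y :=
  opCode_injective c d (funext h)

theorem continuous_op_iff {X : Type*} [TopologicalSpace X] {I : Type} [Finite I]
    {c : I → Colour} {d : Colour} {f : X → (pointsDisks n).Op c d} :
    Continuous f ↔ ∀ i, Continuous fun x => opCode (f x) i := by
  rw [(isInducing_opCode c d).continuous_iff, continuous_pi_iff]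
  rfl

theorem continuous_opCode_apply {I : Type} [Finite I] {c : I → Colour} {d : Colour} (i : I) :
    Continuous fun x : (pointsDisks n).Op c d => opCode x i :=
  (continuous_apply i).comp (continuous_opCode c d)

@[simp]
theorem opCode_one (a : Colour) (i : Unit) : opCode ((pointsDisks n).one a) i = (1, 0) := by
  cases a <;> rfl

@[simp]
theorem opCode_reindex {I J : Type} [Finite I] [Finite J] (e : I ≃ J) {c : I → Colour}
    {c' : J → Colour} {d : Colour} (h : ∀ i, c' (e i) = c i) (x : (pointsDisks n).Op c d)
    (j : J) : opCode ((pointsDisks n).reindex e h x) j = opCode x (e.symm j) := by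
  cases d
  · exact Item.code_recolor _ _
  · rfl

theorem opCode_circ_inl {I J : Type} [Finite I] [Finite J] (i : I) {c : I → Colour}
    {c' : J → Colour} {a d : Colour} (hi : c i = a) (x : (pointsDisks n).Op c d)
    (y : (pointsDisks n).Op c' a) (k : {k : I // k ≠ i}) :
    opCode ((pointsDisks n).circ i hi x y) (Sum.inl k) = opCode x k.1 := by
  cases d <;> cases a
  · rfl
  · rfl
  · rfl
  · rfl

/-- The default code `(1, 0)` for output colour `2` is chosen so that this formula also covers
composition with the identity of colour `2`. -/
theorem opCode_circ_inr {I J : Type} [Finite I] [Finite J] (i : I) {c : I → Colour}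
    {c' : J → Colour} {a d : Colour} (hi : c i = a) (x : (pointsDisks n).Op c d)
    (y : (pointsDisks n).Op c' a) (j : J) :
    opCode ((pointsDisks n).circ i hi x y) (Sum.inr j) = affMul (opCode x i) (opCode y j) := by
  cases d <;> cases a
  · refine (Item.code_act _ _).trans ?_
    exact congrArg (affMul · _) (Item.code_recolor hi (Subtype.val x i))
  · exact (Item.code_recolor _ _).trans (affMul_one _).symm
  -- An operation with output colour `2` has no input of colour `1`.
  · exact nomatch hi.symm.trans (x.down.2 i)
  · exact (affMul_one _).symm

@[simp]
theorem opCode_recolor {I : Type} [Finite I] {c : I → Colour} {d d' : Colour} (h : d = d')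
    (x : (pointsDisks n).Op c d) (i : I) :
    opCode ((pointsDisks n).recolor h x) i = opCode x i := by
  subst h
  rfl

theorem opCode_shift {I : Type} [Finite I] {c c' : I → Colour} (h : ∀ i, c i ≤ c' i)
    (x : (pointsDisks n).Op c .one) (i : I) :
    opCode (pointsDisksShift n h x) i = codeShift (c' i) (opCode x i) :=
  Item.code_shift (h i) (Subtype.val x i)

theorem codeShift_opCode {I : Type} [Finite I] {c : I → Colour} (x : (pointsDisks n).Op c .one)
    (i : I) : codeShift (c i) (opCode x i) = opCode x i :=
  Item.codeShift_code (Subtype.val x i)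

theorem continuous_pointsDisksShift {I : Type} [Finite I] {c c' : I → Colour}
    (h : ∀ i, c i ≤ c' i) : Continuous (pointsDisksShift n h) :=
  continuous_op_iff.2 fun i => by
    simp only [opCode_shift]
    exact (continuous_codeShift _).comp (continuous_opCode_apply i)

end code

/-! ### The operad axioms -/

theorem opCode_reindex_apply {n : ℕ} {I J : Type} [Finite I] [Finite J] (e : I ≃ J)
    {c : I → Colour} {c' : J → Colour} {d : Colour} (h : ∀ i, c' (e i) = c i)
    (x : (pointsDisks n).Op c d) (i : I) :
    opCode ((pointsDisks n).reindex e h x) (e i) = opCode x i := by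
  rw [opCode_reindex, e.symm_apply_apply]

theorem pointsDisks_isOperad (n : ℕ) : (pointsDisks n).IsOperad where
  continuous_reindex e _ _ _ h := continuous_op_iff.2 fun j => by
    simp only [opCode_reindex]
    exact continuous_opCode_apply _
  continuous_circ i _ _ _ _ hi := continuous_op_iff.2 fun k => by
    rcases k with k | j
    · simp only [opCode_circ_inl]
      exact (continuous_opCode_apply _).comp continuous_fst
    · simp only [opCode_circ_inr]
      exact continuous_affMul.comp (((continuous_opCode_apply _).comp continuous_fst).prodMk
        ((continuous_opCode_apply _).comp continuous_snd))
  reindex_refl _ := opCode_ext fun _ => opCode_reindex _ _ _ _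
  reindex_trans _ _ _ _ _ _ _ _ _ := opCode_ext fun _ => by
    rw [opCode_reindex, opCode_reindex]
    refine Eq.symm ?_
    exact opCode_reindex _ _ _ _
  reindex_circ e i _ _ _ _ _ _ _ _ _ := opCode_ext fun k => by
    obtain ⟨k, rfl⟩ := (hostEquiv e i _).surjective k
    refine Eq.trans ?_ (opCode_reindex_apply _ _ _ _).symm
    rcases k with k | j
    · exact (opCode_circ_inl _ _ _ _ _).trans
        ((opCode_reindex_apply _ _ _ _).trans (opCode_circ_inl _ _ _ _ _).symm)
    · refine (opCode_circ_inr _ _ _ _ _).trans (Eq.trans ?_ (opCode_circ_inr _ _ _ _ _).symm)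
      exact congrArg (affMul · _) (opCode_reindex_apply _ _ _ _)
  circ_reindex i e _ _ _ _ _ _ _ _ _ := opCode_ext fun k => by
    obtain ⟨k, rfl⟩ := (guestEquiv i e).surjective k
    refine Eq.trans ?_ (opCode_reindex_apply _ _ _ _).symm
    rcases k with k | j
    · exact (opCode_circ_inl _ _ _ _ _).trans (opCode_circ_inl _ _ _ _ _).symm
    · refine (opCode_circ_inr _ _ _ _ _).trans (Eq.trans ?_ (opCode_circ_inr _ _ _ _ _).symm)
      exact congrArg (affMul _) (opCode_reindex_apply _ _ _ _)
  one_circ _ := opCode_ext fun j => by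
    rw [opCode_reindex]
    refine (opCode_circ_inr _ _ _ _ _).trans ?_
    rw [opCode_one, one_affMul]
  circ_one i _ _ _ hi x := opCode_ext fun k => by
    obtain ⟨k, rfl⟩ := (rightUnitEquiv i).surjective k
    rw [opCode_reindex, Equiv.symm_apply_apply]
    rcases k with k | k
    · exact opCode_circ_inl _ _ _ _ _
    · rw [opCode_circ_inr, opCode_one, affMul_one]
      rfl
  circ_circ i j _ _ _ _ _ _ _ _ _ _ _ := opCode_ext fun k => by
    obtain ⟨k, rfl⟩ := (seqEquiv i j _).surjective k
    refine (opCode_reindex_apply _ _ _ _).trans ?_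
    rcases k with ⟨k | j', h⟩ | l
    · exact ((opCode_circ_inl _ _ _ _ _).trans (opCode_circ_inl _ _ _ _ _)).trans
        (opCode_circ_inl _ _ _ _ _).symm
    · refine ((opCode_circ_inl _ _ _ _ _).trans (opCode_circ_inr _ _ _ _ _)).trans
        (Eq.trans ?_ (opCode_circ_inr _ _ _ _ _).symm)
      refine congrArg (affMul _) (Eq.symm ?_)
      exact opCode_circ_inl _ _ _ _ _
    · refine (opCode_circ_inr _ _ _ _ _).trans
        (Eq.trans ?_ (opCode_circ_inr _ _ _ _ _).symm)
      refine (congrArg (affMul · _) (opCode_circ_inr _ _ _ _ _)).trans ?_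
      exact (affMul_assoc _ _ _).trans (congrArg (affMul _) (opCode_circ_inr _ _ _ _ _).symm)
  circ_comm hik _ _ _ _ _ _ _ _ _ _ _ := opCode_ext fun k => by
    obtain ⟨k, rfl⟩ := (parEquiv hik _ _).surjective k
    refine (opCode_reindex_apply _ _ _ _).trans ?_
    rcases k with ⟨k | j', h⟩ | l
    · exact ((opCode_circ_inl _ _ _ _ _).trans (opCode_circ_inl _ _ _ _ _)).trans
        ((opCode_circ_inl _ _ _ _ _).trans (opCode_circ_inl _ _ _ _ _)).symm
    · refine ((opCode_circ_inl _ _ _ _ _).trans (opCode_circ_inr _ _ _ _ _)).trans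
        (Eq.trans ?_ (opCode_circ_inr _ _ _ _ _).symm)
      refine congrArg (affMul · _) (Eq.symm ?_)
      exact opCode_circ_inl _ _ _ _ _
    · refine (opCode_circ_inr _ _ _ _ _).trans
        (Eq.trans ?_ ((opCode_circ_inl _ _ _ _ _).trans (opCode_circ_inr _ _ _ _ _)).symm)
      exact congrArg (affMul · _) (opCode_circ_inl _ _ _ _ _)

/-! ### The axioms for shifts -/

theorem pointsDisks_point_of_eq (n : ℕ) {I : Type} [Finite I] (c : I → Colour)
    (hI : Nat.card I = 1) (hc : ∀ i, c i = .two) : Nonempty (Unique ((pointsDisks n).Op c .two)) :=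
  ⟨@Unique.mk' _ ⟨⟨hI, hc⟩⟩ inferInstance⟩

theorem pointsDisksShift_refl {n : ℕ} {I : Type} [Finite I] {c : I → Colour} (h : ∀ i, c i ≤ c i)
    (x : (pointsDisks n).Op c .one) : pointsDisksShift n h x = x :=
  opCode_ext fun i => by rw [opCode_shift, codeShift_opCode]

theorem pointsDisksShift_trans {n : ℕ} {I : Type} [Finite I] {c c' c'' : I → Colour}
    (h : ∀ i, c i ≤ c' i) (h' : ∀ i, c' i ≤ c'' i) (h'' : ∀ i, c i ≤ c'' i)
    (x : (pointsDisks n).Op c .one) :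
    pointsDisksShift n h' (pointsDisksShift n h x) = pointsDisksShift n h'' x :=
  opCode_ext fun i => by
    rw [opCode_shift, opCode_shift, opCode_shift, codeShift_codeShift (h' i)]

theorem pointsDisksShift_circ {n : ℕ} {I J : Type} [Finite I] [Finite J] (i : I)
    {c₀ c₁ : I → Colour} {c₂ c₃ : J → Colour} (h : ∀ k, c₀ k ≤ c₁ k) (h' : ∀ j, c₂ j ≤ c₃ j)
    (hs : ∀ k, substProfile c₀ i c₂ k ≤ substProfile c₁ i c₃ k)
    (h₀ : c₀ i = .one) (h₁ : c₁ i = .one) (x : (pointsDisks n).Op c₀ .one)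
    (y : (pointsDisks n).Op c₂ .one) :
    (pointsDisks n).circ i h₁ (pointsDisksShift n h x) (pointsDisksShift n h' y) =
      pointsDisksShift n hs ((pointsDisks n).circ i h₀ x y) :=
  opCode_ext fun k => by
    rw [opCode_shift]
    rcases k with k | j
    · rw [opCode_circ_inl, opCode_circ_inl, opCode_shift]
      rfl
    -- The disk composed into keeps colour `1`, so shifting the host leaves it unchanged.
    · rw [opCode_circ_inr, opCode_circ_inr, opCode_shift, opCode_shift, affMul_codeShift, h₁]
      rfl

theorem pointsDisksShift_reindex {n : ℕ} {I J : Type} [Finite I] [Finite J] (e : I ≃ J)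
    {c c' : I → Colour} {d d' : J → Colour} (h : ∀ i, c i ≤ c' i) (k : ∀ j, d j ≤ d' j)
    (hd : ∀ i, d (e i) = c i) (hd' : ∀ i, d' (e i) = c' i) (x : (pointsDisks n).Op c .one) :
    (pointsDisks n).reindex e hd' (pointsDisksShift n h x) =
      pointsDisksShift n k ((pointsDisks n).reindex e hd x) :=
  opCode_ext fun j => by
    rw [opCode_shift, opCode_reindex, opCode_reindex, opCode_shift, ← hd', e.apply_symm_apply]

/-! ## A criterion for weak homotopy equivalences -/

section PointedSections

universe u v

/-- A surjective map `f` which, for every `x`, has a section through `x` that is a homotopy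
inverse of `f` relative to `x`. -/
def HasPointedSections {X : Type u} {Y : Type v} [TopologicalSpace X] [TopologicalSpace Y]
    (f : C(X, Y)) : Prop :=
  Function.Surjective f ∧ ∀ x : X, ∃ g : C(Y, X), (∀ y, f (g y) = y) ∧ g (f x) = x ∧
    (g.comp f).HomotopicRel (ContinuousMap.id X) {x}

variable {X : Type u} {Y : Type v} [TopologicalSpace X] [TopologicalSpace Y]

theorem ContinuousMap.HomotopicRel.comp_of_mapsTo {Z : Type*} [TopologicalSpace Z] {S : Set X}
    {f₀ f₁ : C(X, Y)} (h : f₀.HomotopicRel f₁ S) (p : C(Z, X)) {B : Set Z}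
    (hp : Set.MapsTo p B S) : (f₀.comp p).HomotopicRel (f₁.comp p) B := by
  obtain ⟨H⟩ := h
  exact ⟨⟨H.toHomotopy.comp (ContinuousMap.Homotopy.refl p),
    fun t z hz => H.eq_fst t (hp hz)⟩⟩

/-- Having a section through each basepoint, with a homotopy fixing it, makes the argument on
homotopy groups strictly based: no change of basepoint occurs. Surjectivity comes from `f ∘ g = id`,
injectivity from the homotopy `g ∘ f ∼ id`. -/
theorem HasPointedSections.isWeakHomotopyEquiv {f : C(X, Y)} (hf : HasPointedSections f) :
    IsWeakHomotopyEquiv f := by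
  refine ⟨f.continuous, ⟨?_, ?_⟩, fun n x _ => ⟨?_, ?_⟩⟩
  · rintro ⟨a⟩ ⟨b⟩ hab
    obtain ⟨g, -, -, ⟨H⟩⟩ := hf.2 a
    have hj : Joined (f a) (f b) := Quotient.exact hab
    have hH : ∀ z, Joined (g (f z)) z := fun z =>
      ⟨⟨H.toContinuousMap.comp ((ContinuousMap.id _).prodMk (ContinuousMap.const _ z)),
        H.apply_zero z, H.apply_one z⟩⟩
    exact Quotient.sound (((hH a).symm.trans (hj.map g.continuous)).trans (hH b))
  · rintro ⟨y⟩
    obtain ⟨x, rfl⟩ := hf.1 y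
    exact ⟨Quotient.mk _ x, rfl⟩
  · rintro ⟨p⟩ ⟨q⟩ hpq
    obtain ⟨g, -, -, H⟩ := hf.2 x
    have hj : (f.comp p.1).HomotopicRel (f.comp q.1) (Cube.boundary (Fin n)) :=
      Quotient.exact hpq
    have key : ∀ r : GenLoop (Fin n) X x,
        (g.comp (f.comp r.1)).HomotopicRel r.1 (Cube.boundary (Fin n)) := fun r =>
      -- A loop sends the boundary of the cube to `x`, where the homotopy is constant.
      H.comp_of_mapsTo r.1 (B := Cube.boundary (Fin n)) fun y hy => r.2 y hy
    exact Quotient.sound (((key p).symm.trans (hj.comp_continuousMap g)).trans (key q))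
  · rintro ⟨q⟩
    obtain ⟨g, hg, hx, -⟩ := hf.2 x
    refine ⟨Quotient.mk _ ⟨g.comp q.1, fun y hy => ?_⟩, ?_⟩
    · exact (congrArg g (q.2 y hy)).trans hx
    · refine congrArg (Quotient.mk _) (Subtype.ext (ContinuousMap.ext fun y => ?_))
      exact hg _

theorem HasPointedSections.exists_homotopyEquiv {f : C(X, Y)} (hf : HasPointedSections f) :
    ∃ e : ContinuousMap.HomotopyEquiv X Y, ∀ x, e x = f x := by
  -- Without a point of `X` there is no section to use; then surjectivity makes `Y` empty as well.
  rcases isEmpty_or_nonempty X with hX | ⟨⟨x⟩⟩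
  · have hY : IsEmpty Y := ⟨fun y => hX.elim (hf.1 y).choose⟩
    refine ⟨⟨f, ⟨hY.elim, ?_⟩, ?_, ?_⟩, fun _ => rfl⟩
    · exact continuous_iff_continuousAt.2 fun y => hY.elim y
    · convert! ContinuousMap.Homotopic.refl _
      exact Subsingleton.elim _ _
    · convert! ContinuousMap.Homotopic.refl _
      exact Subsingleton.elim _ _
  · obtain ⟨g, hg, -, H⟩ := hf.2 x
    refine ⟨⟨f, g, H.homotopic, ?_⟩, fun _ => rfl⟩
    rw [show f.comp g = ContinuousMap.id Y from ContinuousMap.ext hg]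

/-- Sections and homotopies are taken componentwise. The Segal map is handled this way, as a product
of shift maps. -/
theorem HasPointedSections.piMap {ι : Type*} {X : ι → Type u} {Y : ι → Type v}
    [∀ i, TopologicalSpace (X i)] [∀ i, TopologicalSpace (Y i)] {f : ∀ i, C(X i, Y i)}
    (hf : ∀ i, HasPointedSections (f i)) : HasPointedSections (ContinuousMap.piMap f) := by
  refine ⟨fun y => ?_, fun x => ?_⟩
  · choose x hx using fun i => (hf i).1 (y i)
    exact ⟨x, funext hx⟩
  · choose g hg hx H using fun i => (hf i).2 (x i)
    refine ⟨ContinuousMap.piMap g, fun y => funext fun i => hg i _, funext hx, ?_⟩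
    have H' := fun i => (H i).some
    refine ⟨⟨ContinuousMap.Homotopy.piMap fun i => (H' i).toHomotopy, ?_⟩⟩
    rintro t z rfl
    exact funext fun i => (H' i).eq_fst t rfl

theorem HasPointedSections.of_homeomorph {X' Y' : Type*} [TopologicalSpace X']
    [TopologicalSpace Y'] {f : C(X, Y)} (hf : HasPointedSections f) (a : X' ≃ₜ X) (b : Y' ≃ₜ Y)
    {f' : C(X', Y')} (h : ∀ x, b (f' x) = f (a x)) : HasPointedSections f' := by
  refine ⟨fun y => ?_, fun x => ?_⟩
  · obtain ⟨x, hx⟩ := hf.1 (b y)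
    exact ⟨a.symm x, b.injective (by rw [h, a.apply_symm_apply, hx])⟩
  · obtain ⟨g, hg, hx, H⟩ := hf.2 (a x)
    refine ⟨((a.symm : C(X, X')).comp g).comp (b : C(Y', Y)), fun y => b.injective ?_, ?_, ?_⟩
    · rw [h]
      simp [hg]
    · simp [h, hx]
    · have H' := (H.comp_of_mapsTo (a : C(X', X)) (B := {x})
        (by rintro _ rfl; rfl)).comp_continuousMap (a.symm : C(X, X'))
      convert! H' using 1
      · ext z
        simp [h]
      · ext z
        simp

end PointedSections

/-! ## Shift maps have pointed sections -/

section Codes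

variable {n : ℕ}

/-- Validity of an item in terms of radius and centre. -/
def ValidCode : Colour → ℝ × Euc n → Prop
  | .one, a => 0 < a.1 ∧ Metric.ball a.2 a.1 ⊆ unitDisk n
  | .two, a => a.1 = 0 ∧ a.2 ∈ unitDisk n

/-- Apartness of items in terms of radii and centres. -/
def ApartCode : Colour → Colour → ℝ × Euc n → ℝ × Euc n → Prop
  | .one, .one, a, b => a.1 + b.1 ≤ dist a.2 b.2
  | .one, .two, a, b => a.1 + b.1 < dist a.2 b.2
  | .two, .one, a, b => a.1 + b.1 < dist a.2 b.2
  | .two, .two, a, b => a.1 + b.1 < dist a.2 b.2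

theorem ApartCode.lt {k l : Colour} {a b : ℝ × Euc n} (h : ApartCode k l a b)
    (hkl : k = .two ∨ l = .two) : a.1 + b.1 < dist a.2 b.2 := by
  cases k <;> cases l
  · rcases hkl with h | h <;> cases h
  exacts [h, h, h]

theorem Item.valid_iff {k : Colour} {x : Item n k} : x.Valid ↔ ValidCode k x.code := by
  cases k
  · exact and_congr_right fun h => by rw [diskOf_eq_ball h]; rfl
  · exact (and_iff_right rfl).symm

theorem notMem_closure_diskOf_iff {a : ℝ × Euc n} (ha : 0 < a.1) {d : Euc n} :
    d ∉ closure (diskOf a) ↔ a.1 < dist a.2 d := by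
  rw [diskOf_eq_ball ha, closure_ball _ ha.ne', Metric.mem_closedBall, not_le, dist_comm]

/-- In a real normed space, balls are disjoint exactly when the radii add up to at most the distance
of the centres, and the closure of a ball is the closed ball. With radius `0` for points, all four
cases compare the sum of radii with the distance, strictly as soon as a point is involved. -/
theorem Item.apart_iff {k l : Colour} {x : Item n k} {y : Item n l} (hx : x.Valid)
    (hy : y.Valid) : x.Apart y ↔ ApartCode k l x.code y.code := by
  cases k <;> cases l
  · have hx' : 0 < Prod.fst x := hx.1
    have hy' : 0 < Prod.fst y := hy.1
    refine Iff.trans ?_ (disjoint_ball_ball_iff hx' hy')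
    exact (Iff.of_eq (congrArg₂ Disjoint (diskOf_eq_ball hx') (diskOf_eq_ball hy')))
  · exact (notMem_closure_diskOf_iff hx.1).trans (by simp [ApartCode, Item.code])
  · exact (notMem_closure_diskOf_iff hy.1).trans (Iff.trans
      (Iff.of_eq (congrArg (Prod.fst y < ·) (dist_comm _ _))) (by simp [ApartCode, Item.code]))
  · exact Iff.trans dist_pos.symm (by simp [ApartCode, Item.code])

/-- Families of radii and centres that form a configuration of type `c`. -/
def IsConfigCode {I : Type} (c : I → Colour) (p : I → ℝ × Euc n) : Prop :=
  (∀ i, ValidCode (c i) (p i)) ∧ ∀ i j, i ≠ j → ApartCode (c i) (c j) (p i) (p j)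

theorem isConfigCode_opCode {I : Type} [Finite I] {c : I → Colour}
    (x : (pointsDisks n).Op c .one) : IsConfigCode c (opCode x) :=
  ⟨fun i => Item.valid_iff.1 (x.2.1 i),
    fun i j hij => (Item.apart_iff (x.2.1 i) (x.2.1 j)).1 (x.2.2 i j hij)⟩

theorem ValidCode.codeShift_eq {k : Colour} {a : ℝ × Euc n} (h : ValidCode k a) :
    codeShift k a = a := by
  cases k
  · rfl
  · exact Prod.ext h.1.symm rfl

/-- The configuration with the given radii and centres. -/
def opOfCode {I : Type} [Finite I] {c : I → Colour} {p : I → ℝ × Euc n}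
    (h : IsConfigCode c p) : (pointsDisks n).Op c .one :=
  have hv : ∀ i, (Item.ofCode (c i) (p i)).Valid := fun i => by
    rw [Item.valid_iff, Item.code_ofCode, (h.1 i).codeShift_eq]
    exact h.1 i
  (⟨fun i => Item.ofCode (c i) (p i), hv, fun i j hij => by
    rw [Item.apart_iff (hv i) (hv j), Item.code_ofCode, Item.code_ofCode, (h.1 i).codeShift_eq,
      (h.1 j).codeShift_eq]
    exact h.2 i j hij⟩ : DiskConfig n c)

@[simp]
theorem opCode_opOfCode {I : Type} [Finite I] {c : I → Colour} {p : I → ℝ × Euc n}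
    (h : IsConfigCode c p) (i : I) : opCode (opOfCode h) i = p i :=
  (Item.code_ofCode (c i) (p i)).trans (h.1 i).codeShift_eq

/-! ### Interpolation of radii -/

/-- The convex combination of two configurations with the same centres. -/
def lerpCode (t : ℝ) (a b : ℝ × Euc n) : ℝ × Euc n := ((1 - t) * a.1 + t * b.1, a.2)

/-- For fixed centres, all conditions on the radii are convex. -/
theorem IsConfigCode.lerp {I : Type} {c : I → Colour} {p q : I → ℝ × Euc n}
    (hp : IsConfigCode c p) (hq : IsConfigCode c q) (hpq : ∀ i, (p i).2 = (q i).2) {t : ℝ}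
    (ht : t ∈ Set.Icc (0 : ℝ) 1) : IsConfigCode c fun i => lerpCode t (p i) (q i) := by
  have ht0 := ht.1
  have ht1 : 0 ≤ 1 - t := sub_nonneg.2 ht.2
  have hlt : ∀ {a b d : ℝ}, a < d → b < d → (1 - t) * a + t * b < d := fun {a b d} ha hb => by
    have := convex_Iio d ha hb ht1 ht0 (by ring)
    simpa using this
  refine ⟨fun i => ?_, fun i j hij => ?_⟩
  · have h1 := hp.1 i
    have h2 := hq.1 i
    have h3 := hpq i
    generalize c i = k at h1 h2
    cases k
    · refine ⟨?_, fun y hy => ?_⟩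
      · have := convex_Ioi (0 : ℝ) h1.1 h2.1 ht1 ht0 (by ring)
        simpa [lerpCode] using this
      -- A point outside the unit disk lies outside both balls, so its distance to the centre bounds
      -- both radii and hence their average. An estimate of the radius by `1 - ‖c‖` is not
      -- available, since it fails for `n = 0`.
      · by_contra hy'
        have ha : (p i).1 ≤ dist y (p i).2 := not_lt.1 fun h => hy' (h1.2 h)
        have hb : (q i).1 ≤ dist y (p i).2 := not_lt.1 fun h => hy' (h2.2 (by rwa [← h3]))
        have hm : dist y (p i).2 < (1 - t) * (p i).1 + t * (q i).1 := hy
        nlinarith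
    · refine ⟨?_, h1.2⟩
      simp [lerpCode, h1.1, h2.1]
  · have h1 := hp.2 i j hij
    have h2 := hq.2 i j hij
    rw [show q i = ((q i).1, (p i).2) from Prod.ext rfl (hpq i).symm,
      show q j = ((q j).1, (p j).2) from Prod.ext rfl (hpq j).symm] at h2
    have hle : ((lerpCode t (p i) (q i)).1 + (lerpCode t (p j) (q j)).1) =
        (1 - t) * ((p i).1 + (p j).1) + t * ((q i).1 + (q j).1) := by
      simp only [lerpCode]
      ring
    generalize c i = k at h1 h2 ⊢
    generalize c j = l at h1 h2 ⊢
    cases k <;> cases l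
    · refine hle.trans_le ?_
      have := convex_Iic (dist (p i).2 (p j).2) h1 h2 ht1 ht0 (by ring)
      exact this
    all_goals exact hle.trans_lt (hlt h1 h2)

/-! ### Thickening points to disks -/

/-- Give a point of radius `0` the radius `r` if it is to become a disk. -/
def thickenCode : Colour → Colour → ℝ → ℝ × Euc n → ℝ × Euc n
  | .one, .two, r, a => (r, a.2)
  | _, _, _, a => a

theorem continuous_thickenCode (k l : Colour) :
    Continuous fun p : ℝ × (ℝ × Euc n) => thickenCode k l p.1 p.2 := by
  cases k <;> cases l <;> simp only [thickenCode] <;> fun_prop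

theorem thickenCode_snd (k l : Colour) (r : ℝ) (a : ℝ × Euc n) :
    (thickenCode k l r a).2 = a.2 := by
  cases k <;> cases l <;> rfl

theorem codeShift_thickenCode {k l : Colour} {r : ℝ} {a : ℝ × Euc n} (ha : ValidCode l a) :
    codeShift l (thickenCode k l r a) = a := by
  cases k <;> cases l
  · rfl
  · exact Prod.ext ha.1.symm rfl
  · rfl
  · exact Prod.ext ha.1.symm rfl

theorem thickenCode_codeShift {k l : Colour} (h : k ≤ l) {a : ℝ × Euc n} (ha : ValidCode k a) :
    thickenCode k l a.1 (codeShift l a) = a := by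
  cases k <;> cases l
  · rfl
  · rfl
  · exact nomatch h rfl
  · exact Prod.ext ha.1.symm rfl

theorem ValidCode.norm_lt {k : Colour} {a : ℝ × Euc n} (ha : ValidCode k a) : ‖a.2‖ < 1 := by
  cases k
  · exact mem_ball_zero_iff.1 (ha.2 (Metric.mem_ball_self ha.1))
  · exact mem_ball_zero_iff.1 ha.2

/-- Turn `z` into the direction of `a`: the resulting point of the ball has norm `‖a‖ + ‖z‖`. The
bound concerns vectors rather than the radius because in dimension `0` the radius may be arbitrarily
large. -/
theorem norm_add_norm_lt_of_ball_subset {a z : Euc n} {r : ℝ}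
    (h : Metric.ball a r ⊆ unitDisk n) (hz : ‖z‖ < r) : ‖a‖ + ‖z‖ < 1 := by
  rcases eq_or_ne a 0 with rfl | ha
  · have := h (show z ∈ Metric.ball 0 r by simpa using hz)
    simpa [unitDisk] using this
  · have ha' : 0 < ‖a‖ := norm_pos_iff.2 ha
    have hm : a + (‖z‖ / ‖a‖) • a ∈ Metric.ball a r := by
      rw [mem_ball_iff_norm, add_sub_cancel_left, norm_smul, norm_div, norm_norm, norm_norm,
        div_mul_cancel₀ _ ha'.ne']
      exact hz
    have h1 := mem_ball_zero_iff.1 (h hm)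
    have h2 : a + (‖z‖ / ‖a‖) • a = (1 + ‖z‖ / ‖a‖) • a := by rw [add_smul, one_smul]
    rw [h2, norm_smul, Real.norm_of_nonneg (by positivity), add_mul, one_mul,
      div_mul_cancel₀ _ ha'.ne'] at h1
    exact h1

/-- Rescaling by `s⁻¹` moves an offset from `b` to an offset from `a` inside the given ball; its
length is then at most the room `1 - ‖a‖`, and the scaled room fits into `1 - ‖b‖`. -/
theorem ball_subset_unitDisk_of_mul_le {a b : Euc n} {r s : ℝ} (hs : 0 < s)
    (h : Metric.ball a r ⊆ unitDisk n) (hab : s * (1 - ‖a‖) ≤ 1 - ‖b‖) :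
    Metric.ball b (s * r) ⊆ unitDisk n := by
  intro y hy
  rw [mem_ball_iff_norm] at hy
  have h1 : ‖s⁻¹ • (y - b)‖ = s⁻¹ * ‖y - b‖ := by
    rw [norm_smul, norm_inv, Real.norm_of_nonneg hs.le]
  have h2 := norm_add_norm_lt_of_ball_subset h (z := s⁻¹ • (y - b))
    (by rw [h1, inv_mul_lt_iff₀ hs]; exact hy)
  rw [h1] at h2
  have h3 := mul_lt_mul_of_pos_left h2 hs
  rw [mul_add, mul_inv_cancel_left₀ hs.ne'] at h3
  refine mem_ball_zero_iff.2 ?_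
  have h4 : ‖y‖ ≤ ‖b‖ + ‖y - b‖ := by
    simpa using norm_add_le b (y - b)
  linarith

theorem ValidCode.thicken {k l : Colour} (h : k ≤ l) {a b : ℝ × Euc n} (ha : ValidCode k a)
    (hb : ValidCode l b) {s : ℝ} (hs : 0 < s) (hab : s * (1 - ‖a.2‖) ≤ 1 - ‖b.2‖) :
    ValidCode k (thickenCode k l (s * a.1) b) := by
  cases k <;> cases l
  · exact hb
  · exact ⟨mul_pos hs ha.1, ball_subset_unitDisk_of_mul_le hs ha.2 hab⟩
  · exact nomatch h rfl
  · exact hb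

/-- The distance between two items, where items of colour `2` are regarded as points. -/
noncomputable def gapCode (k l : Colour) (a b : ℝ × Euc n) : ℝ :=
  dist a.2 b.2 - (codeShift k a).1 - (codeShift l b).1

/-- The radii to be restored fit into the gap left after forgetting them in the old configuration.
Scaled by `s` they fit into `s` times that gap, hence into the new gap. Pairs that remain disks are
copied from the new configuration. -/
theorem ApartCode.thicken {k k' l l' : Colour} (hk : k ≤ k') (hl : l ≤ l')
    {a b a' b' : ℝ × Euc n} (ha : ValidCode k a) (hb : ValidCode l b)
    (hab : ApartCode k l a b) (ha' : ValidCode k' a') (hb' : ValidCode l' b')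
    (hab' : ApartCode k' l' a' b') {s : ℝ} (hs : 0 < s)
    (h : (k' = .two ∨ l' = .two) → s * gapCode k' l' a b ≤ gapCode k' l' a' b') :
    ApartCode k l (thickenCode k k' (s * a.1) a') (thickenCode l l' (s * b.1) b') := by
  cases k <;> cases k' <;> cases l <;> cases l' <;>
    first
    | exact Colour.noConfusion (hk rfl)
    | exact Colour.noConfusion (hl rfl)
    | exact hab'
    | skip
  all_goals
    simp only [ApartCode, gapCode, codeShift, thickenCode, ValidCode, reduceCtorEq, or_true,
      true_or, forall_const, sub_zero] at *
    nlinarith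

/-- Take the minimum of `1` and the quotients `f k y / f k y₀`, all of which equal `1` at `y₀`. -/
theorem exists_continuous_scale {Y K : Type*} [TopologicalSpace Y] [Finite K] (f : K → Y → ℝ)
    (hf : ∀ k, Continuous (f k)) (hpos : ∀ k y, 0 < f k y) (y₀ : Y) :
    ∃ s : Y → ℝ, Continuous s ∧ (∀ y, 0 < s y) ∧ s y₀ = 1 ∧
      ∀ k y, s y * f k y₀ ≤ f k y := by
  have := Fintype.ofFinite K
  -- The extra constant function `1` keeps the minimum defined when `K` is empty.
  let F : Option K → Y → ℝ := fun o y => o.elim 1 fun k => f k y / f k y₀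
  have hF : ∀ o y, 0 < F o y := fun o y => by
    cases o
    · exact one_pos
    · exact div_pos (hpos _ _) (hpos _ _)
  have hF₀ : ∀ o, F o y₀ = 1 := fun o => by
    cases o
    · rfl
    · exact div_self (hpos _ _).ne'
  refine ⟨fun y => Finset.univ.inf' ⟨none, Finset.mem_univ _⟩ fun o => F o y, ?_, fun y => ?_,
    ?_, fun k y => ?_⟩
  · refine Continuous.finset_inf'_apply _ fun o _ => ?_
    cases o
    · exact continuous_const
    · exact (hf _).div_const _
  · exact (Finset.lt_inf'_iff _).2 fun o _ => hF o y
  · simp only [hF₀]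
    exact Finset.inf'_const _ _
  · rw [← le_div_iff₀ (hpos k y₀)]
    exact Finset.inf'_le (fun o => F o y) (Finset.mem_univ (some k))

variable {I : Type} {c c' : I → Colour}

theorem IsConfigCode.gap_pos {p : I → ℝ × Euc n} (hp : IsConfigCode c p) {i j : I} (hij : i ≠ j)
    (h : c i = .two ∨ c j = .two) : 0 < gapCode (c i) (c j) (p i) (p j) := by
  have h1 := (hp.2 i j hij).lt h
  rw [gapCode, (hp.1 i).codeShift_eq, (hp.1 j).codeShift_eq]
  linarith

theorem gapCode_codeShift {k k' l l' : Colour} (hk : k ≤ k') (hl : l ≤ l') (a b : ℝ × Euc n) :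
    gapCode k' l' (codeShift k a) (codeShift l b) = gapCode k' l' a b := by
  rw [gapCode, gapCode, codeShift_codeShift hk, codeShift_codeShift hl, codeShift_snd,
    codeShift_snd]

theorem ValidCode.thicken_of_lt {k l : Colour} (h : k ≤ l) {a : ℝ × Euc n} (ha : ValidCode l a)
    {r : ℝ} (hr : 0 < r) (hra : r < 1 - ‖a.2‖) : ValidCode k (thickenCode k l r a) := by
  cases k <;> cases l
  · exact ha
  · refine ⟨hr, fun z hz => mem_ball_zero_iff.2 ?_⟩
    have h1 : ‖z - a.2‖ < r := mem_ball_iff_norm.1 hz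
    have h2 : ‖z‖ ≤ ‖a.2‖ + ‖z - a.2‖ := by
      simpa using norm_add_le a.2 (z - a.2)
    linarith
  · exact Colour.noConfusion (h rfl)
  · exact ha

/-- Half of the gap is allowed for each item because both may be thickened by `r`. -/
theorem ApartCode.thicken_of_lt {k k' l l' : Colour} (hk : k ≤ k') (hl : l ≤ l')
    {a b : ℝ × Euc n} (ha : ValidCode k' a) (hb : ValidCode l' b) (hab : ApartCode k' l' a b)
    {r : ℝ} (hr : 0 < r) (h : (k' = .two ∨ l' = .two) → r < gapCode k' l' a b / 2) :
    ApartCode k l (thickenCode k k' r a) (thickenCode l l' r b) := by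
  cases k <;> cases k' <;> cases l <;> cases l' <;>
    first
    | exact Colour.noConfusion (hk rfl)
    | exact Colour.noConfusion (hl rfl)
    | exact hab
    | skip
  all_goals
    simp only [ApartCode, gapCode, codeShift, thickenCode, ValidCode, reduceCtorEq, or_true,
      true_or, forall_const, sub_zero] at *
    linarith

theorem surjective_pointsDisksShift [Finite I] (h : ∀ i, c i ≤ c' i) :
    Function.Surjective (pointsDisksShift n h) := by
  intro y
  have hy := isConfigCode_opCode y
  obtain ⟨r, ⟨hr₁, hr₂⟩, hr⟩ : ∃ r : ℝ, ((∀ i, r < 1 - ‖(opCode y i).2‖) ∧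
      ∀ i j, i ≠ j → (c' i = .two ∨ c' j = .two) →
        r < gapCode (c' i) (c' j) (opCode y i) (opCode y j) / 2) ∧ 0 < r := by
    have hev : ∀ b : ℝ, 0 < b → ∀ᶠ r in 𝓝[>] (0 : ℝ), r < b := fun b hb =>
      (eventually_lt_nhds hb).filter_mono nhdsWithin_le_nhds
    have h1 : ∀ᶠ r in 𝓝[>] (0 : ℝ), ∀ i, r < 1 - ‖(opCode y i).2‖ :=
      Filter.eventually_all.2 fun i => hev _ (sub_pos.2 (hy.1 i).norm_lt)
    have h2 : ∀ᶠ r in 𝓝[>] (0 : ℝ), ∀ i j, i ≠ j → (c' i = .two ∨ c' j = .two) →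
        r < gapCode (c' i) (c' j) (opCode y i) (opCode y j) / 2 := by
      refine Filter.eventually_all.2 fun i => Filter.eventually_all.2 fun j => ?_
      by_cases hij : i ≠ j ∧ (c' i = .two ∨ c' j = .two)
      · exact (hev _ (half_pos (hy.gap_pos hij.1 hij.2))).mono fun r hr _ _ => hr
      · exact Filter.Eventually.of_forall fun r h1 h2 => (hij ⟨h1, h2⟩).elim
    exact ((h1.and h2).and self_mem_nhdsWithin).exists
  have hx : IsConfigCode c fun i => thickenCode (c i) (c' i) r (opCode y i) :=
    ⟨fun i => (hy.1 i).thicken_of_lt (h i) hr (hr₁ i), fun i j hij =>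
      (hy.2 i j hij).thicken_of_lt (h i) (h j) (hy.1 i) (hy.1 j) hr (hr₂ i j hij)⟩
  refine ⟨opOfCode hx, opCode_ext fun i => ?_⟩
  rw [opCode_shift, opCode_opOfCode, codeShift_thickenCode (hy.1 i)]

/-! ### The section and the deformation -/

open Classical in
/-- The quantities that have to stay positive in a configuration of type `c`. -/
noncomputable def configGap (c : I → Colour) : I ⊕ I × I → (I → ℝ × Euc n) → ℝ
  | .inl i, p => 1 - ‖(p i).2‖
  -- Two disks may touch, so their gap need not be positive. Such pairs, and equal indices, get the
  -- harmless value `1`.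
  | .inr q, p => if q.1 ≠ q.2 ∧ (c q.1 = .two ∨ c q.2 = .two) then
      gapCode (c q.1) (c q.2) (p q.1) (p q.2) else 1

theorem continuous_configGap (c : I → Colour) (k : I ⊕ I × I) :
    Continuous (configGap (n := n) c k) := by
  rcases k with i | q
  · unfold configGap
    fun_prop
  · by_cases hq : q.1 ≠ q.2 ∧ (c q.1 = .two ∨ c q.2 = .two)
    · rw [show configGap (n := n) c (.inr q) = fun p => gapCode (c q.1) (c q.2) (p q.1) (p q.2)
        from funext fun p => if_pos hq]
      have h1 := continuous_codeShift (n := n) (c q.1)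
      have h2 := continuous_codeShift (n := n) (c q.2)
      unfold gapCode
      fun_prop
    · rw [show configGap (n := n) c (.inr q) = fun _ => 1 from funext fun p => if_neg hq]
      exact continuous_const

theorem IsConfigCode.configGap_pos {p : I → ℝ × Euc n} (hp : IsConfigCode c p)
    (k : I ⊕ I × I) : 0 < configGap c k p := by
  rcases k with i | q
  · exact sub_pos.2 (hp.1 i).norm_lt
  · by_cases hq : q.1 ≠ q.2 ∧ (c q.1 = .two ∨ c q.2 = .two)
    · exact (hp.gap_pos hq.1 hq.2).trans_eq (if_pos hq).symm
    · exact one_pos.trans_eq (if_neg hq).symm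

theorem hasPointedSections_pointsDisksShift [Finite I] (h : ∀ i, c i ≤ c' i) :
    HasPointedSections ⟨pointsDisksShift n h, continuous_pointsDisksShift h⟩ := by
  refine ⟨surjective_pointsDisksShift h, fun x₀ => ?_⟩
  have hx₀ := isConfigCode_opCode x₀
  have hcode : ∀ x i, opCode (pointsDisksShift n h x) i = codeShift (c' i) (opCode x i) :=
    fun x i => opCode_shift h x i
  obtain ⟨s, hs, hs₀, hs₁, hsf⟩ := exists_continuous_scale
    (fun k (y : (pointsDisks n).Op c' .one) => configGap c' k (opCode y))
    (fun k => (continuous_configGap c' k).comp (continuous_opCode c' .one))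
    (fun k y => (isConfigCode_opCode y).configGap_pos k) (pointsDisksShift n h x₀)
  -- The section: centres from `y`, restored radii from `x₀` scaled by `s y`.
  have hg : ∀ y : (pointsDisks n).Op c' .one, IsConfigCode c fun i =>
      thickenCode (c i) (c' i) (s y * (opCode x₀ i).1) (opCode y i) := fun y => by
    have hy := isConfigCode_opCode y
    refine ⟨fun i => ?_, fun i j hij => ?_⟩
    · refine (hx₀.1 i).thicken (h i) (hy.1 i) (hs₀ y) ?_
      have := hsf (Sum.inl i) y
      simpa only [configGap, hcode, codeShift_snd] using this
    · refine (hx₀.2 i j hij).thicken (h i) (h j) (hx₀.1 i) (hx₀.1 j) (hy.1 i) (hy.1 j)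
        (hy.2 i j hij) (hs₀ y) fun hc => ?_
      have := hsf (Sum.inr (i, j)) y
      have hq : i ≠ j ∧ (c' i = .two ∨ c' j = .two) := ⟨hij, hc⟩
      simp only [configGap, if_pos hq, hcode] at this
      -- The gaps for `c'` ignore the forgotten radii, so they agree for `x₀` and its shift.
      rwa [gapCode_codeShift (fun h => h) (fun h => h)] at this
  let g : C((pointsDisks n).Op c' .one, (pointsDisks n).Op c .one) :=
    ⟨fun y => opOfCode (hg y), continuous_op_iff.2 fun i => by
      simp only [opCode_opOfCode]
      exact (continuous_thickenCode _ _).comp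
        ((hs.mul continuous_const).prodMk (continuous_opCode_apply i))⟩
  have hgc : ∀ y i, opCode (g y) i =
      thickenCode (c i) (c' i) (s y * (opCode x₀ i).1) (opCode y i) :=
    fun y i => opCode_opOfCode (hg y) i
  have hgx₀ : g (pointsDisksShift n h x₀) = x₀ := opCode_ext fun i => by
    rw [hgc, hs₁, one_mul, hcode, thickenCode_codeShift (h i) (hx₀.1 i)]
  refine ⟨g, fun y => opCode_ext fun i => ?_, hgx₀, ?_⟩
  · refine (hcode _ _).trans ?_
    rw [hgc, codeShift_thickenCode ((isConfigCode_opCode y).1 i)]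
  -- Shift followed by section changes radii only, so `x` and its image have the same centres and
  -- can be interpolated.
  · have hH : ∀ q : unitInterval × (pointsDisks n).Op c .one, IsConfigCode c fun i =>
        lerpCode q.1 (opCode (g (pointsDisksShift n h q.2)) i) (opCode q.2 i) := fun q =>
      (isConfigCode_opCode _).lerp (isConfigCode_opCode q.2)
        (fun i => by rw [hgc, thickenCode_snd, hcode, codeShift_snd]) q.1.2
    refine ⟨⟨⟨⟨fun q => opOfCode (hH q), ?_⟩, fun x => ?_, fun x => ?_⟩, ?_⟩⟩
    · refine continuous_op_iff.2 fun i => ?_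
      simp only [opCode_opOfCode]
      have h1 : Continuous fun q : unitInterval × (pointsDisks n).Op c .one =>
          opCode (g (pointsDisksShift n h q.2)) i := (continuous_opCode_apply i).comp
        (g.continuous.comp ((continuous_pointsDisksShift h).comp continuous_snd))
      have h2 : Continuous fun q : unitInterval × (pointsDisks n).Op c .one =>
          opCode q.2 i := (continuous_opCode_apply i).comp continuous_snd
      unfold lerpCode
      fun_prop
    · refine opCode_ext fun i => (opCode_opOfCode (hH (0, x)) i).trans ?_
      simp [lerpCode]
    · refine opCode_ext fun i => (opCode_opOfCode (hH (1, x)) i).trans ?_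
      refine Prod.ext (by simp [lerpCode]) ?_
      simp only [lerpCode]
      rw [hgc, thickenCode_snd, hcode, codeShift_snd]
      rfl
    · rintro t x rfl
      refine opCode_ext fun i => (opCode_opOfCode (hH (t, x)) i).trans ?_
      change lerpCode t (opCode (g (pointsDisksShift n h x)) i) (opCode x i) =
        opCode (g (pointsDisksShift n h x)) i
      rw [hgx₀]
      exact Prod.ext (by simp only [lerpCode]; ring) rfl

end Codes

theorem pointsDisks_isOperadWithShifts (n : ℕ) :
    IsOperadWithShifts (pointsDisks n) (pointsDisksShift n) where
  isOperad := pointsDisks_isOperad n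
  point_of_eq := pointsDisks_point_of_eq n
  empty_of_ne _ h := ⟨fun x => h x.down⟩
  weakEquiv h := (hasPointedSections_pointsDisksShift h).isWeakHomotopyEquiv
  shift_refl := pointsDisksShift_refl
  shift_trans := pointsDisksShift_trans
  shift_circ := pointsDisksShift_circ
  shift_reindex := pointsDisksShift_reindex

/-! ## Operad maps out of the operad of a tree -/

namespace DTree

variable {T : DTree}

theorem Subtree.eq_singleton {A : Set T.E} {e : T.E} (h : T.Subtree A e) (he : T.IsLeaf e) :
    A = {e} := by
  cases h with
  | edge => rfl
  | graft v => exact (he v rfl).elim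

theorem notMem_inp_out (v : T.V) : T.out v ∉ T.inp v := fun h =>
  T.not_transGen_self _ (.single ⟨v, h, rfl⟩)

theorem not_isLeaf_out (v : T.V) : ¬ T.IsLeaf (T.out v) := fun h => h v rfl

theorem not_isLeaf_iff {e : T.E} : ¬ T.IsLeaf e ↔ ∃ v, T.out v = e := by
  simp [IsLeaf]

theorem Subtree.mono_of_mem_inp {v : T.V} {C : T.E → Set T.E} (h : ∀ x ∈ T.inp v,
    T.Subtree (C x) x) {x y : T.E} (hx : x ∈ T.inp v) (hy : y ∈ T.inp v) (hxy : x ∈ C y) :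
    x = y := by
  have h1 : T.Subtree (T.inp v) (T.out v) := by simpa using (T.isOp_vertex v).2
  exact h1.antichain hx hy ((h y hy).reach hxy)

/-- Subtrees can be built by successively grafting single vertices. -/
theorem Subtree.graft_induction {motive : Set T.E → T.E → Prop} (edge : ∀ e, motive {e} e)
    (graft : ∀ A e v, T.Subtree A e → T.out v ∈ A → motive A e →
      motive ((A \ {T.out v}) ∪ T.inp v) e) {B : Set T.E} {b : T.E} (hB : T.Subtree B b) :
    motive B b := by
  -- Generalised to grafting `B` onto a leaf of an arbitrary subtree, so that the hypothesis can be
  -- applied at each input of a vertex in turn.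
  have key : ∀ {B b}, T.Subtree B b → ∀ A e, T.Subtree A e → b ∈ A → motive A e →
      motive ((A \ {b}) ∪ B) e := by
    intro B b hB
    induction hB with
    | edge b =>
      intro A e _ hb hm
      rwa [Set.sdiff_union_of_subset (Set.singleton_subset_iff.2 hb)]
    | graft v C hC ih =>
      intro A e hA hv hm
      -- Once `v` is grafted, the branches over its inputs are added one by one; `s` is the set of
      -- inputs already treated.
      have main : ∀ s : Set T.E, s ⊆ T.inp v →
          T.Subtree ((A \ {T.out v}) ∪ ((T.inp v \ s) ∪ ⋃ x ∈ s, C x)) e ∧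
          motive ((A \ {T.out v}) ∪ ((T.inp v \ s) ∪ ⋃ x ∈ s, C x)) e := by
        intro s hs
        induction s, Set.toFinite s using Set.Finite.induction_on with
        | empty =>
          have h1 := graft A e v hA hv hm
          have h2 := hA.subst hv (by simpa using (T.isOp_vertex v).2)
          simpa using ⟨h2, h1⟩
        | @insert x s hxs _ ihs =>
          obtain ⟨hx, hs'⟩ := Set.insert_subset_iff.1 hs
          obtain ⟨h1, h2⟩ := ihs hs'
          -- Deleting `x` must remove only the input of `v`: it is neither an old leaf nor a leaf of
          -- another branch, since leaves of a subtree are incomparable.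
          have hxA : x ∉ A := fun hxA => by
            have h3 : x = T.out v := hA.antichain hxA hv (.single ⟨v, hx, rfl⟩)
            exact notMem_inp_out v (h3 ▸ hx)
          have hxC : x ∉ ⋃ y ∈ s, C y := fun h => by
            obtain ⟨y, hy, hxy⟩ := Set.mem_iUnion₂.1 h
            exact hxs (Subtree.mono_of_mem_inp hC hx (hs' hy) hxy ▸ hy)
          have hmem : x ∈ (A \ {T.out v}) ∪ ((T.inp v \ s) ∪ ⋃ y ∈ s, C y) :=
            Or.inr (Or.inl ⟨hx, hxs⟩)
          have heq : (((A \ {T.out v}) ∪ ((T.inp v \ s) ∪ ⋃ y ∈ s, C y)) \ {x}) ∪ C x =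
              (A \ {T.out v}) ∪ ((T.inp v \ insert x s) ∪ ⋃ y ∈ insert x s, C y) := by
            rw [Set.biUnion_insert]
            ext z
            simp only [Set.mem_union, Set.mem_sdiff, Set.mem_singleton_iff, Set.mem_insert_iff]
            have h5 : z = x → z ∉ A := fun h => h ▸ hxA
            have h6 : z = x → z ∉ ⋃ y ∈ s, C y := fun h => h ▸ hxC
            tauto
          rw [← heq]
          exact ⟨h1.subst hmem (hC x hx), ih x hx _ e h1 hmem h2⟩
      have h := (main (T.inp v) subset_rfl).2
      rwa [sdiff_self, Set.bot_eq_empty, Set.empty_union] at h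
  have h := key hB {b} b (Subtree.edge b) rfl (edge b)
  rwa [sdiff_self, Set.bot_eq_empty, Set.empty_union] at h

theorem IsOp.range_substProfile {I J : Type} (i : I) {c : I → T.E} {c' : J → T.E} {d : T.E}
    (hc : T.IsOp c d) :
    Set.range (substProfile c i c') = (Set.range c \ {c i}) ∪ Set.range c' := by
  ext b
  simp only [substProfile, Set.Sum.elim_range, Set.mem_union, Set.mem_sdiff, Set.mem_range,
    Set.mem_singleton_iff, Subtype.exists]
  refine or_congr_left ⟨?_, ?_⟩
  · rintro ⟨k, hk, rfl⟩
    exact ⟨⟨k, rfl⟩, fun h => hk (hc.1 h)⟩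
  · rintro ⟨⟨k, rfl⟩, hk⟩
    exact ⟨k, fun h => hk (congrArg c h), rfl⟩

/-- Maps out of `Ω(T)` are determined by their values on the vertices. -/
theorem operadMap_ext {C : Type} {Q : OperadData C} {f : T.E → C}
    {F G : OperadMap T.operad Q f}
    (h : ∀ v, F.toFun (T.vertexOp v) = G.toFun (T.vertexOp v)) : F = G := by
  -- Enumerations of the same set of leaves differ by a relabelling, so only the set of leaves
  -- matters.
  have reduce : ∀ {I J : Type} [Finite I] [Finite J] {c : I → T.E} {c' : J → T.E} {d : T.E}
      (p : T.operad.Op c d) (p' : T.operad.Op c' d), Set.range c = Set.range c' →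
      F.toFun p = G.toFun p → F.toFun p' = G.toFun p' := by
    intro I J _ _ c c' d p p' hr hp
    let e : I ≃ J := (Equiv.ofInjective c p.down.1).trans
      ((Equiv.setCongr hr).trans (Equiv.ofInjective c' p'.down.1).symm)
    have he : ∀ i, c' (e i) = c i := fun i => by
      simp only [e, Equiv.trans_apply, Equiv.apply_ofInjective_symm]
      rfl
    rw [Subsingleton.elim p' (T.operad.reindex e he p), F.map_reindex, G.map_reindex, hp]
  have key : ∀ {A : Set T.E} {d : T.E}, T.Subtree A d → ∀ {I : Type} [Finite I] {c : I → T.E}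
      (p : T.operad.Op c d), Set.range c = A → F.toFun p = G.toFun p := by
    intro A d hA
    refine Subtree.graft_induction (motive := fun A d => ∀ {I : Type} [Finite I] {c : I → T.E}
      (p : T.operad.Op c d), Set.range c = A → F.toFun p = G.toFun p) ?_ ?_ hA
    · intro e I _ c p hc
      exact reduce (T.operad.one e) p (Set.range_const.trans hc.symm)
        ((F.map_one e).trans (G.map_one e).symm)
    · intro A e v hA hv ih I _ c p hc
      have q : T.operad.Op (fun a : A => a.1) e :=
        ⟨Subtype.val_injective, by simpa using hA⟩
      refine reduce (T.operad.circ ⟨T.out v, hv⟩ rfl q (T.vertexOp v)) p ?_ ?_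
      · rw [hc, q.down.range_substProfile]
        simp
      · rw [F.map_circ, G.map_circ, ih q (by simp), h v]
  ext I _ c d p
  exact key p.down.2 p rfl

open Classical in
/-- Leaves have colour `2`, all other edges have colour `1`. -/
noncomputable def colour (T : DTree) (e : T.E) : Colour := if T.IsLeaf e then .two else .one

theorem colour_of_isLeaf {e : T.E} (h : T.IsLeaf e) : T.colour e = .two := if_pos h

theorem colour_of_not_isLeaf {e : T.E} (h : ¬ T.IsLeaf e) : T.colour e = .one := if_neg h

theorem colour_out (v : T.V) : T.colour (T.out v) = .one := colour_of_not_isLeaf (not_isLeaf_out v)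

theorem IsOp.eq_of_isLeaf {I : Type} {c : I → T.E} {d : T.E} (p : T.IsOp c d)
    (hd : T.IsLeaf d) (i : I) : c i = d := by
  have h := p.2.eq_singleton hd
  exact Set.mem_singleton_iff.1 (h ▸ ⟨i, rfl⟩)

theorem IsOp.card_of_isLeaf {I : Type} {c : I → T.E} {d : T.E} (p : T.IsOp c d)
    (hd : T.IsLeaf d) : Nat.card I = 1 := by
  have h : Set.range c = {d} := p.2.eq_singleton hd
  rw [Nat.card_congr (Equiv.ofInjective c p.1), h]
  simp

/-- Operad maps `Ω(T) → O` which send leaves to `2` and all other edges to `1`. -/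
abbrev LeafMap (n : ℕ) (T : DTree) : Type 1 := OperadMap T.operad (pointsDisks n) T.colour

end DTree

theorem opCode_of_eq_two {n : ℕ} {I : Type} [Finite I] {c : I → Colour} {d : Colour}
    (hd : d = .two) (x : (pointsDisks n).Op c d) (i : I) : opCode x i = (1, 0) := by
  subst hd
  rfl

theorem op_eq_of_eq_two {n : ℕ} {I : Type} [Finite I] {c : I → Colour} {d : Colour}
    (hd : d = .two) (x y : (pointsDisks n).Op c d) : x = y :=
  opCode_ext fun i => by rw [opCode_of_eq_two hd, opCode_of_eq_two hd]

namespace DTree.LeafMap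

variable {n : ℕ} {T : DTree}

/-- The data of a map in `LeafMap n T`: the position `w e d` of an edge `e` relative to an
edge `d` below it. -/
structure Positions (n : ℕ) (T : DTree) where
  w : T.E → T.E → ℝ × Euc n
  isConfigCode : ∀ {I : Type} {c : I → T.E} {d : T.E}, T.IsOp c d → ¬ T.IsLeaf d →
    IsConfigCode (fun i => T.colour (c i)) fun i => w (c i) d
  w_self : ∀ d, ¬ T.IsLeaf d → w d d = (1, 0)
  w_comp : ∀ e a d, ¬ T.IsLeaf a → ¬ T.IsLeaf d → w e d = affMul (w a d) (w e a)

open Classical in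
/-- The operation belonging to a subtree. -/
noncomputable def Positions.op (P : Positions n T) {I : Type} [Finite I] {c : I → T.E} {d : T.E}
    (p : T.IsOp c d) : (pointsDisks n).Op (fun i => T.colour (c i)) (T.colour d) :=
  if hd : T.IsLeaf d then
    (pointsDisks n).recolor (colour_of_isLeaf hd).symm
      (⟨p.card_of_isLeaf hd, fun i => by
          change T.colour (c i) = _
          rw [p.eq_of_isLeaf hd, colour_of_isLeaf hd]⟩ :
        (pointsDisks n).Op (fun i => T.colour (c i)) .two)
  else (pointsDisks n).recolor (colour_of_not_isLeaf hd).symm (opOfCode (P.isConfigCode p hd))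

theorem Positions.opCode_op (P : Positions n T) {I : Type} [Finite I] {c : I → T.E} {d : T.E}
    (p : T.IsOp c d) (hd : ¬ T.IsLeaf d) (i : I) : opCode (P.op p) i = P.w (c i) d := by
  rw [Positions.op, dif_neg hd, opCode_recolor, opCode_opOfCode]

/-- The map belonging to given relative positions. -/
noncomputable def ofPositions (P : Positions n T) : LeafMap n T where
  toFun p := P.op p.down
  continuous_toFun := continuous_of_discreteTopology
  map_one a := by
    by_cases ha : T.IsLeaf a
    · exact op_eq_of_eq_two (colour_of_isLeaf ha) _ _
    · refine opCode_ext fun i => ?_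
      rw [P.opCode_op _ ha, opCode_one, P.w_self _ ha]
  map_reindex {I J _ _} e {c c' d} h p := by
    by_cases hd : T.IsLeaf d
    · exact op_eq_of_eq_two (colour_of_isLeaf hd) _ _
    · refine opCode_ext fun j => ?_
      rw [P.opCode_op _ hd, opCode_reindex, P.opCode_op _ hd, ← h, e.apply_symm_apply]
  map_circ {I J _ _} i {c c' a d} hi p q := by
    by_cases hd : T.IsLeaf d
    · exact op_eq_of_eq_two (colour_of_isLeaf hd) _ _
    · refine opCode_ext fun k => ?_
      rw [P.opCode_op _ hd, opCode_reindex]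
      rcases k with k | j
      · refine Eq.trans ?_ (opCode_circ_inl _ _ _ _ _).symm
        rw [P.opCode_op _ hd]
        rfl
      · refine Eq.trans ?_ (opCode_circ_inr _ _ _ _ _).symm
        rw [P.opCode_op _ hd]
        -- Over a leaf the only subtree is the edge itself, and `q` goes to the identity of colour
        -- `2`.
        by_cases ha : T.IsLeaf a
        · rw [opCode_of_eq_two (colour_of_isLeaf ha), affMul_one, hi, ← q.down.eq_of_isLeaf ha j]
          rfl
        · rw [P.opCode_op _ ha, hi, ← P.w_comp _ _ _ ha hd]
          rfl

theorem opCode_ofPositions (P : Positions n T) {I : Type} [Finite I] {c : I → T.E} {d : T.E}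
    (p : T.operad.Op c d) (hd : ¬ T.IsLeaf d) (i : I) :
    opCode ((ofPositions P).toFun p) i = P.w (c i) d :=
  P.opCode_op p.down hd i

/-- The topology is pointwise, and values at subtrees rooted in a leaf have constant code. -/
theorem continuous_iff {X : Type*} [TopologicalSpace X] {f : X → LeafMap n T} :
    Continuous f ↔ ∀ {I : Type} [Finite I] {c : I → T.E} {d : T.E} (p : T.operad.Op c d) (i : I),
      ¬ T.IsLeaf d → Continuous fun x => opCode ((f x).toFun p) i := by
  refine Iff.trans (b := ∀ (I : Type) (_ : Finite I) (c : I → T.E) (d : T.E)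
    (p : T.operad.Op c d), Continuous fun x => (f x).toFun p) ?_ ?_
  · simp only [continuous_iInf_rng, continuous_induced_rng]
    rfl
  · refine ⟨fun h I _ c d p i _ => continuous_op_iff.1 (h I _ c d p) i,
      fun h I _ c d p => continuous_op_iff.2 fun i => ?_⟩
    by_cases hd : T.IsLeaf d
    · simp only [opCode_of_eq_two (colour_of_isLeaf hd)]
      exact continuous_const
    · exact h p i hd

theorem continuous_opCode_toFun {I : Type} [Finite I] {c : I → T.E} {d : T.E}
    (p : T.operad.Op c d) (i : I) : Continuous fun F : LeafMap n T => opCode (F.toFun p) i := by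
  by_cases hd : T.IsLeaf d
  · simp only [opCode_of_eq_two (colour_of_isLeaf hd)]
    exact continuous_const
  · exact continuous_iff.1 continuous_id p i hd

end DTree.LeafMap

/-! ## Freeness of the operad of a tree -/

section Codes

variable {n : ℕ}

theorem ValidCode.valid_ofCode {k : Colour} {a : ℝ × Euc n} (h : ValidCode k a) :
    (Item.ofCode k a).Valid := by
  rwa [Item.valid_iff, Item.code_ofCode, h.codeShift_eq]

theorem Item.code_act_ofCode (a : ℝ × Euc n) {k : Colour} (x : Item n k) :
    (x.act (Item.ofCode .one a : Item n .one)).code = affMul a x.code :=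
  Item.code_act a x

theorem ValidCode.comp {k : Colour} {a b : ℝ × Euc n} (ha : ValidCode .one a)
    (hb : ValidCode k b) : ValidCode k (affMul a b) := by
  have ha' := ha.valid_ofCode
  have h := Item.valid_iff.1 (hb.valid_ofCode.act ha'.1 ha'.2)
  rw [Item.code_act_ofCode, Item.code_ofCode, hb.codeShift_eq] at h
  exact h

theorem ApartCode.apart_ofCode {k l : Colour} {a b : ℝ × Euc n} (ha : ValidCode k a)
    (hb : ValidCode l b) (h : ApartCode k l a b) :
    (Item.ofCode k a).Apart (Item.ofCode l b) := by
  rwa [Item.apart_iff ha.valid_ofCode hb.valid_ofCode, Item.code_ofCode, Item.code_ofCode,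
    ha.codeShift_eq, hb.codeShift_eq]

theorem ApartCode.symm {k l : Colour} {a b : ℝ × Euc n} (h : ApartCode k l a b) :
    ApartCode l k b a := by
  cases k <;> cases l <;> simp only [ApartCode, dist_comm b.2, add_comm b.1] at h ⊢ <;> exact h

theorem ApartCode.comp {k l : Colour} {a b b' : ℝ × Euc n} (ha : ValidCode .one a)
    (hb : ValidCode k b) (hb' : ValidCode l b') (h : ApartCode k l b b') :
    ApartCode k l (affMul a b) (affMul a b') := by
  have ha' := ha.valid_ofCode
  have h' := (Item.apart_iff (hb.valid_ofCode.act ha'.1 ha'.2)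
    (hb'.valid_ofCode.act ha'.1 ha'.2)).1 ((h.apart_ofCode hb hb').act ha'.1)
  rw [Item.code_act_ofCode, Item.code_ofCode, hb.codeShift_eq, Item.code_act_ofCode, Item.code_ofCode,
    hb'.codeShift_eq] at h'
  exact h'

theorem ApartCode.comp_right {k l : Colour} {a x y : ℝ × Euc n} (ha : ValidCode .one a)
    (hx : ValidCode k x) (hy : ValidCode l y) (h : ApartCode k .one x a) :
    ApartCode k l x (affMul a y) := by
  have ha' := ha.valid_ofCode
  have h' := (Item.apart_iff hx.valid_ofCode (hy.valid_ofCode.act ha'.1 ha'.2)).1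
    (Item.Apart.act_right ha' hy.valid_ofCode (h.apart_ofCode hx ha))
  rw [Item.code_act_ofCode, Item.code_ofCode, hx.codeShift_eq, Item.code_ofCode, hy.codeShift_eq] at h'
  exact h'

end Codes

/-! ### Extending configurations at the vertices to an operad map -/

namespace DTree

variable {n : ℕ} {T : DTree}

/-- Allows recursion from the root upwards: the predecessor of an edge is the unique edge one step
below it. -/
theorem wellFounded_step (T : DTree) : WellFounded fun a b => T.Step b a := by
  refine ⟨fun e => ?_⟩
  induction T.reach e using Relation.ReflTransGen.head_induction_on with
  | refl => exact ⟨_, fun y hy => by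
      obtain ⟨v, hv, -⟩ := hy
      exact (T.root_notMem v hv).elim⟩
  | head h _ ih => exact ⟨_, fun y hy => T.step_rightUnique h hy ▸ ih⟩

/-- A configuration for every vertex of `T`. -/
abbrev VertexData (n : ℕ) (T : DTree) : Type :=
  ∀ v : T.V, (pointsDisks n).Op (fun e : T.inp v => T.colour e.1) .one

namespace VertexData

open Classical in
/-- The position of an edge relative to the root. -/
noncomputable def abs (z : VertexData n T) : T.E → ℝ × Euc n :=
  T.wellFounded_step.fix fun e ih =>
    if h : ∃ v, e ∈ T.inp v then
      affMul (ih (T.out h.choose) ⟨h.choose, h.choose_spec, rfl⟩)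
        (opCode (z h.choose) ⟨e, h.choose_spec⟩)
    else (1, 0)

theorem abs_of_mem (z : VertexData n T) {v : T.V} {e : T.E} (he : e ∈ T.inp v) :
    z.abs e = affMul (z.abs (T.out v)) (opCode (z v) ⟨e, he⟩) := by
  have h : ∃ v, e ∈ T.inp v := ⟨v, he⟩
  rw [abs, WellFounded.fix_eq, dif_pos h]
  obtain rfl : h.choose = v := T.inp_unique h.choose_spec he
  rfl

theorem abs_of_forall_notMem (z : VertexData n T) {e : T.E} (he : ∀ v, e ∉ T.inp v) :
    z.abs e = (1, 0) := by
  rw [abs, WellFounded.fix_eq, dif_neg fun h => he h.choose h.choose_spec]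

theorem validCode (z : VertexData n T) {v : T.V} {e : T.E} (he : e ∈ T.inp v)
    (hl : ¬ T.IsLeaf e) : ValidCode .one (opCode (z v) ⟨e, he⟩) := by
  have h : ValidCode (T.colour e) (opCode (z v) ⟨e, he⟩) := (isConfigCode_opCode (z v)).1 ⟨e, he⟩
  rwa [colour_of_not_isLeaf hl] at h

theorem abs_pos (z : VertexData n T) {e : T.E} (he : ¬ T.IsLeaf e) : 0 < (z.abs e).1 := by
  induction e using T.wellFounded_step.induction with
  | _ e ih =>
    by_cases h : ∃ v, e ∈ T.inp v
    · obtain ⟨v, hv⟩ := h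
      rw [abs_of_mem z hv]
      refine mul_pos (ih _ ⟨v, hv, rfl⟩ (not_isLeaf_out v)) ?_
      exact (z.validCode hv he).1
    · rw [abs_of_forall_notMem z (not_exists.1 h)]
      exact one_pos

theorem continuous_abs (e : T.E) : Continuous fun z : VertexData n T => z.abs e := by
  induction e using T.wellFounded_step.induction with
  | _ e ih =>
    by_cases h : ∃ v, e ∈ T.inp v
    · obtain ⟨v, hv⟩ := h
      simp only [abs_of_mem _ hv]
      exact continuous_affMul.comp ((ih _ ⟨v, hv, rfl⟩).prodMk
        ((continuous_opCode_apply _).comp (continuous_apply v)))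
    · simp only [abs_of_forall_notMem _ (not_exists.1 h)]
      exact continuous_const

/-- The position of the edge `e` relative to the edge `d`. -/
noncomputable def rel (z : VertexData n T) (e d : T.E) : ℝ × Euc n :=
  affMul (affInv (z.abs d)) (z.abs e)

theorem rel_self (z : VertexData n T) (d : T.E) (hd : ¬ T.IsLeaf d) : z.rel d d = (1, 0) :=
  affInv_affMul (z.abs_pos hd).ne'

/-- Cocycle identity for quotients of affine maps; `a` must carry a disk to be invertible. No
relation between the edges in the tree is needed. -/
theorem rel_comp (z : VertexData n T) (e a d : T.E) (ha : ¬ T.IsLeaf a) :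
    z.rel e d = affMul (z.rel a d) (z.rel e a) := by
  rw [rel, rel, rel, affMul_assoc, ← affMul_assoc (z.abs a),
    affMul_affInv (z.abs_pos ha).ne', one_affMul]

theorem rel_out (z : VertexData n T) {v : T.V} {e : T.E} (he : e ∈ T.inp v) :
    z.rel e (T.out v) = opCode (z v) ⟨e, he⟩ := by
  rw [rel, abs_of_mem z he, ← affMul_assoc, affInv_affMul (z.abs_pos (not_isLeaf_out v)).ne',
    one_affMul]

theorem continuous_rel (e d : T.E) (hd : ¬ T.IsLeaf d) :
    Continuous fun z : VertexData n T => z.rel e d := by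
  have h1 := continuous_abs (n := n) e
  have h2 := continuous_abs (n := n) d
  have h3 : Continuous fun z : VertexData n T => ((z.abs d).1)⁻¹ :=
    h2.fst.inv₀ fun z => (z.abs_pos hd).ne'
  refine continuous_affMul.comp (Continuous.prodMk ?_ h1)
  exact h3.prodMk (h3.smul h2.snd).neg

/-- Items in the same branch are handled by the induction hypothesis, transported by the affine map
of that branch. Items in different branches lie inside items that are already apart at `v`. -/
theorem isConfigCode_rel_of_subtree (z : VertexData n T) {A : Set T.E} {d : T.E}
    (hA : T.Subtree A d) (hd : ¬ T.IsLeaf d) :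
    (∀ a ∈ A, ValidCode (T.colour a) (z.rel a d)) ∧ ∀ a ∈ A, ∀ b ∈ A, a ≠ b →
      ApartCode (T.colour a) (T.colour b) (z.rel a d) (z.rel b d) := by
  induction hA with
  | edge e =>
    refine ⟨?_, fun a ha b hb hab => (hab (ha.trans hb.symm)).elim⟩
    rintro a rfl
    rw [z.rel_self a hd, colour_of_not_isLeaf hd]
    exact ⟨one_pos, subset_rfl⟩
  | graft v A hA ih =>
    have hz := isConfigCode_opCode (z v)
    have hv : ∀ e ∈ T.inp v, ∀ a ∈ A e, ValidCode (T.colour a) (z.rel a (T.out v)) := by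
      intro e he a ha
      by_cases hl : T.IsLeaf e
      · obtain rfl : a = e := by
          rw [(hA e he).eq_singleton hl] at ha
          exact ha
        rw [z.rel_out he]
        exact hz.1 ⟨a, he⟩
      · have h1 := z.validCode he hl
        rw [z.rel_comp a e _ hl, z.rel_out he]
        exact h1.comp ((ih e he hl).1 a ha)
    -- What is apart from the item at `e` is apart from everything in the branch over `e`. Used
    -- twice below, once for each branch.
    have key : ∀ e (he : e ∈ T.inp v), ∀ a ∈ A e, ∀ (k : Colour) (x : ℝ × Euc n),
        ValidCode k x → ApartCode k (T.colour e) x (opCode (z v) ⟨e, he⟩) →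
        ApartCode k (T.colour a) x (z.rel a (T.out v)) := by
      intro e he a ha k x hx hxe
      by_cases hl : T.IsLeaf e
      · obtain rfl : a = e := by
          rw [(hA e he).eq_singleton hl] at ha
          exact ha
        rwa [z.rel_out he]
      · have h1 := z.validCode he hl
        rw [colour_of_not_isLeaf hl] at hxe
        rw [z.rel_comp a e _ hl, z.rel_out he]
        exact hxe.comp_right h1 hx ((ih e he hl).1 a ha)
    refine ⟨fun a ha => ?_, fun a ha b hb hab => ?_⟩
    · obtain ⟨e, he, ha⟩ := Set.mem_iUnion₂.1 ha
      exact hv e he a ha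
    · obtain ⟨e, he, ha⟩ := Set.mem_iUnion₂.1 ha
      obtain ⟨e', he', hb⟩ := Set.mem_iUnion₂.1 hb
      by_cases hee : e = e'
      · subst hee
        by_cases hl : T.IsLeaf e
        · rw [(hA e he).eq_singleton hl] at ha hb
          exact (hab (ha.trans hb.symm)).elim
        · have h1 := z.validCode he hl
          rw [z.rel_comp a e _ hl, z.rel_comp b e _ hl, z.rel_out he]
          exact ((ih e he hl).2 a ha b hb hab).comp h1 ((ih e he hl).1 a ha)
            ((ih e he hl).1 b hb)
      · refine key e' he' b hb _ _ (hv e he a ha) ?_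
        refine (key e he a ha _ _ (hz.1 ⟨e', he'⟩) ?_).symm
        exact hz.2 ⟨e', he'⟩ ⟨e, he⟩ fun h => hee (congrArg Subtype.val h).symm

/-- The relative positions of the edges determined by configurations at the vertices. -/
noncomputable def positions (z : VertexData n T) : LeafMap.Positions n T where
  w := z.rel
  isConfigCode p hd :=
    have h := z.isConfigCode_rel_of_subtree p.2 hd
    ⟨fun i => h.1 _ ⟨i, rfl⟩, fun i j hij => h.2 _ ⟨i, rfl⟩ _ ⟨j, rfl⟩ (p.1.ne hij)⟩
  w_self := z.rel_self
  w_comp e a d ha _ := z.rel_comp e a d ha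

end VertexData

/-- The values of a map at the vertices. -/
noncomputable def LeafMap.vertexData (F : LeafMap n T) : VertexData n T := fun v =>
  (pointsDisks n).recolor (colour_out v) (F.toFun (T.vertexOp v))

theorem LeafMap.opCode_vertexData (F : LeafMap n T) (v : T.V) (e : T.inp v) :
    opCode (F.vertexData v) e = opCode (F.toFun (T.vertexOp v)) e :=
  opCode_recolor _ _ _

/-- Maps `Ω(T) → O` are the same as configurations at the vertices of `T`. -/
noncomputable def leafMapHomeo (n : ℕ) (T : DTree) : LeafMap n T ≃ₜ VertexData n T where
  toFun F := F.vertexData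
  invFun z := LeafMap.ofPositions z.positions
  left_inv F := T.operadMap_ext fun v => opCode_ext fun e => by
    rw [LeafMap.opCode_ofPositions _ _ (not_isLeaf_out v)]
    exact (VertexData.rel_out _ e.2).trans (F.opCode_vertexData v e)
  right_inv z := funext fun v => opCode_ext fun e => by
    rw [LeafMap.opCode_vertexData, LeafMap.opCode_ofPositions _ _ (not_isLeaf_out v)]
    exact z.rel_out e.2
  continuous_toFun := continuous_pi fun v => continuous_op_iff.2 fun e => by
    simp only [LeafMap.opCode_vertexData]
    exact LeafMap.continuous_opCode_toFun _ _
  continuous_invFun := LeafMap.continuous_iff.2 fun p i hd => by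
    simp only [LeafMap.opCode_ofPositions _ _ hd]
    exact VertexData.continuous_rel _ _ hd

theorem LeafMap.opCode_toFun (F : LeafMap n T) {I : Type} [Finite I] {c : I → T.E} {d : T.E}
    (p : T.operad.Op c d) (hd : ¬ T.IsLeaf d) (i : I) :
    opCode (F.toFun p) i = F.vertexData.rel (c i) d := by
  have h := (leafMapHomeo n T).symm_apply_apply F
  conv_lhs => rw [← h]
  exact LeafMap.opCode_ofPositions _ _ hd i

end DTree

/-! ## The semi-dendroidal space of points and little disks -/

namespace DTree

variable {n : ℕ} {R S T : DTree}

/-- An operation of `Ω(T)` with output a leaf is an identity. A vertex of `S` sent to one would have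
its input and its output identified, against injectivity. -/
theorem Hom.not_isLeaf_edge (α : S ⟶ T) (hα : Function.Injective α.edge) {e : S.E}
    (he : ¬ S.IsLeaf e) : ¬ T.IsLeaf (α.edge e) := by
  obtain ⟨v, rfl⟩ := not_isLeaf_iff.1 he
  intro hl
  have p := (α.map.toFun (S.vertexOp v)).down
  obtain ⟨⟨i⟩, -⟩ := Nat.card_pos_iff.1 ((p.card_of_isLeaf hl).symm ▸ Nat.one_pos)
  exact notMem_inp_out v (hα (p.eq_of_isLeaf hl i) ▸ i.2)

theorem Hom.colour_le (α : S ⟶ T) (hα : Function.Injective α.edge) (e : S.E) :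
    T.colour (α.edge e) ≤ S.colour e := by
  intro h
  by_contra h'
  have he : ¬ S.IsLeaf e := fun he => h' (colour_of_isLeaf he)
  rw [colour_of_not_isLeaf (Hom.not_isLeaf_edge α hα he)] at h
  cases h

theorem codeShift_opCode_of_eq {I : Type} [Finite I] {c : I → Colour} {d : Colour}
    (hd : d = .one) (x : (pointsDisks n).Op c d) (i : I) :
    codeShift (c i) (opCode x i) = opCode x i := by
  subst hd
  exact codeShift_opCode x i

namespace LeafMap

/-- Restriction along a map of trees, followed by the shift at the leaves. -/
noncomputable def restrict (α : S ⟶ T) (hα : Function.Injective α.edge) (F : LeafMap n T) :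
    LeafMap n S :=
  ofPositions
    { w := fun e d => codeShift (S.colour e) (F.vertexData.rel (α.edge e) (α.edge d))
      isConfigCode := fun {I c d} p hd => by
        have : Finite I := Finite.of_injective c p.1
        have hd' := Hom.not_isLeaf_edge α hα hd
        -- These positions are the code of the shift of the restricted operation, so they form a
        -- configuration.
        have h := isConfigCode_opCode (pointsDisksShift n (fun i => Hom.colour_le α hα (c i))
          ((pointsDisks n).recolor (colour_of_not_isLeaf hd')
            (F.toFun (α.map.toFun (⟨p⟩ : S.operad.Op c d)))))
        convert h using 2 with i
        rw [opCode_shift, opCode_recolor, F.opCode_toFun _ hd']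
      w_self := fun d hd => by
        rw [VertexData.rel_self _ _ (Hom.not_isLeaf_edge α hα hd), colour_of_not_isLeaf hd]
        rfl
      w_comp := fun e a d ha _ => by
        rw [VertexData.rel_comp _ _ _ _ (Hom.not_isLeaf_edge α hα ha), ← affMul_codeShift,
          colour_of_not_isLeaf ha]
        rfl }

theorem opCode_restrict (α : S ⟶ T) (hα : Function.Injective α.edge) (F : LeafMap n T)
    {I : Type} [Finite I] {c : I → S.E} {d : S.E} (p : S.operad.Op c d) (hd : ¬ S.IsLeaf d)
    (i : I) : opCode ((restrict α hα F).toFun p) i =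
      codeShift (S.colour (c i)) (opCode (F.toFun (α.map.toFun p)) i) := by
  rw [restrict, opCode_ofPositions _ _ hd, F.opCode_toFun _ (Hom.not_isLeaf_edge α hα hd)]

theorem continuous_restrict (α : S ⟶ T) (hα : Function.Injective α.edge) :
    Continuous (restrict (n := n) α hα) :=
  continuous_iff.2 fun p i hd => by
    simp only [opCode_restrict α hα _ p hd]
    exact (continuous_codeShift _).comp (continuous_opCode_toFun _ i)

theorem ext_opCode {F G : LeafMap n T} (h : ∀ {I : Type} [Finite I] {c : I → T.E} {d : T.E}
    (p : T.operad.Op c d) (i : I), ¬ T.IsLeaf d → opCode (F.toFun p) i = opCode (G.toFun p) i) :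
    F = G :=
  T.operadMap_ext fun v => opCode_ext fun i => h _ i (not_isLeaf_out v)

theorem restrict_id (h : Function.Injective (Hom.edge (𝟙 T))) (F : LeafMap n T) :
    restrict (𝟙 T) h F = F :=
  ext_opCode fun p i hd => by
    rw [opCode_restrict _ _ _ _ hd]
    exact codeShift_opCode_of_eq (colour_of_not_isLeaf hd) (F.toFun p) i

/-- The shift at the leaves of `S` is absorbed by the shift at the leaves of `R`, because colours
only increase under restriction. -/
theorem restrict_comp (α : R ⟶ S) (β : S ⟶ T) (hα : Function.Injective α.edge)
    (hβ : Function.Injective β.edge) (hαβ : Function.Injective (α ≫ β).edge) (F : LeafMap n T) :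
    restrict (α ≫ β) hαβ F = restrict α hα (restrict β hβ F) :=
  ext_opCode fun p i hd => by
    rw [opCode_restrict _ _ _ _ hd, opCode_restrict _ _ _ _ hd,
      opCode_restrict _ _ _ _ (Hom.not_isLeaf_edge α hα hd),
      codeShift_codeShift (Hom.colour_le α hα _)]
    rfl

end LeafMap

theorem edge_injective_of_isIso (f : S ⟶ T) [IsIso f] : Function.Injective f.edge := by
  refine Function.LeftInverse.injective (g := (inv f).edge) fun e => ?_
  exact congrFun (congrArg Hom.edge (IsIso.hom_inv_id f)) e

theorem edge_injective_of_mem {f : S ⟶ T} (hf : isoOrFace.multiplicativeClosure f) :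
    Function.Injective f.edge := by
  have of : ∀ {S T : DTree} (f : S ⟶ T), isoOrFace f → Function.Injective f.edge := by
    rintro S T f (h | ⟨_, _, _, h, _⟩ | ⟨_, _, h, _⟩ | ⟨_, _, _, _, _, h, _⟩)
    · exact edge_injective_of_isIso f
    · exact h
    · exact h
    · exact h
  induction hf with
  | of f hf => exact of f hf
  | id => exact fun _ _ h => h
  | comp_of f g _ hg ih => exact (of g hg).comp ih

theorem not_isLeaf_root (hT : ¬ T.IsTrivial) : ¬ T.IsLeaf T.root := by
  obtain ⟨v⟩ := not_isEmpty_iff.1 hT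
  rcases (Relation.ReflTransGen.cases_tail (T.reach (T.out v))) with h | ⟨b, -, w, -, hw⟩
  · exact fun hl => hl v h.symm
  · exact fun hl => hl w hw.symm

/-- Maps with the prescribed colours form the space `X_T`. -/
noncomputable def leafMapHomeoShiftSpace (n : ℕ) (T : DTree) (hT : ¬ T.IsTrivial) :
    LeafMap n T ≃ₜ ShiftSpace (pointsDisks n) T :=
  let g : LeafMap n T → ShiftSpace (pointsDisks n) T := fun F =>
    ⟨⟨T.colour, F⟩, fun _ he => colour_of_isLeaf he,
      colour_of_not_isLeaf (not_isLeaf_root hT), fun _ he _ => colour_of_not_isLeaf he⟩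
  -- The colours of an element of `X_T` are forced, so `X_T` is a single summand of the nerve.
  have hg : IsEmbedding g := by
    refine IsEmbedding.of_comp (g := Subtype.val) ?_ continuous_subtype_val ?_
    · exact Continuous.subtype_mk (continuous_sigmaMk
        (σ := fun f : T.E → Colour => OperadMap T.operad (pointsDisks n) f) (i := T.colour)) _
    · exact IsEmbedding.sigmaMk (σ := fun f : T.E → Colour => OperadMap T.operad (pointsDisks n) f)
        (i := T.colour)
  hg.toHomeomorphOfSurjective <| by
    rintro ⟨⟨f, F⟩, h1, h2, h3⟩
    obtain rfl : f = T.colour := funext fun e => by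
      by_cases he : T.IsLeaf e
      · rw [colour_of_isLeaf he]
        exact h1 e he
      · rw [colour_of_not_isLeaf he]
        by_cases hr : e = T.root
        · rw [hr]
          exact h2
        · exact h3 e he hr
    exact ⟨F, rfl⟩

end DTree

/-- The semi-dendroidal space associated with the operad of points and little disks. -/
noncomputable def pointsDisksSpace (n : ℕ) : SemiDendroidalSpace where
  obj T := TopCat.of (DTree.LeafMap n T.unop.obj)
  map f := TopCat.ofHom ⟨DTree.LeafMap.restrict f.unop.hom
    (DTree.edge_injective_of_mem f.unop.property), DTree.LeafMap.continuous_restrict _ _⟩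
  map_id T := by
    refine TopCat.hom_ext (ContinuousMap.ext fun F => ?_)
    exact DTree.LeafMap.restrict_id (fun _ _ h => h) F
  map_comp f g := by
    refine TopCat.hom_ext (ContinuousMap.ext fun F => ?_)
    exact DTree.LeafMap.restrict_comp g.unop.hom f.unop.hom
      (DTree.edge_injective_of_mem g.unop.property)
      (DTree.edge_injective_of_mem f.unop.property)
      (DTree.edge_injective_of_mem (f ≫ g).unop.property) F

/-- A tree without vertices gives an empty product of configuration spaces, so `η` needs no separate
definition. -/
theorem nonempty_unique_pointsDisksSpace (n : ℕ) (T : DTree) (hT : T.IsTrivial) :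
    Nonempty (Unique ((pointsDisksSpace n).obj (.op T.inj))) := by
  have hV : IsEmpty T.V := hT
  exact ⟨(DTree.leafMapHomeo n T).toEquiv.unique⟩

/-- `pointsDisksSpace n` is associated with the operad of points and little disks. -/
noncomputable def pointsDisksSpaceAssociated (n : ℕ) :
    AssociatedTo (pointsDisks n) (pointsDisksShift n) (pointsDisksSpace n) where
  point := nonempty_unique_pointsDisksSpace n
  homeo T hT := DTree.leafMapHomeoShiftSpace n T hT
  map {S T} α hS hT F := by
    have hα := DTree.edge_injective_of_mem α.property
    refine ⟨fun e he => DTree.colour_of_isLeaf he, fun e he => ?_, fun v hx hy hle => ?_⟩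
    · exact (DTree.colour_of_not_isLeaf he).trans
        (DTree.colour_of_not_isLeaf (DTree.Hom.not_isLeaf_edge α.hom hα he)).symm
    · refine opCode_ext fun i => (opCode_recolor _ _ _).trans ?_
      refine (DTree.LeafMap.opCode_restrict α.hom hα F _ (DTree.not_isLeaf_out v) i).trans ?_
      refine Eq.trans ?_ (opCode_shift _ _ _).symm
      rw [opCode_recolor]
      rfl

/-! ## Corolla inclusions are composites of face maps -/

namespace DTree

variable {S T : DTree}

/-- A map of trees given by an injective map on edges that sends vertices to subtrees. -/
def homOfSubtree (g : S.E → T.E) (hg : Function.Injective g)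
    (h : ∀ v, T.Subtree (g '' S.inp v) (g (S.out v))) : S ⟶ T where
  edge := g
  map :=
    { toFun := fun {I _ c d} p => ⟨hg.comp p.down.1, by
        have key : ∀ {A : Set S.E} {d : S.E}, S.Subtree A d → T.Subtree (g '' A) (g d) := by
          intro A d hA
          refine Subtree.graft_induction (motive := fun A d => T.Subtree (g '' A) (g d))
            (fun e => ?_) (fun A e v _ hv ih => ?_) hA
          · rw [Set.image_singleton]
            exact Subtree.edge _
          · rw [Set.image_union, Set.image_sdiff hg, Set.image_singleton]
            exact ih.subst (Set.mem_image_of_mem g hv) (h v)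
        have h' := key p.down.2
        rwa [← Set.range_comp] at h'⟩
      continuous_toFun := continuous_of_discreteTopology
      map_one := fun _ => Subsingleton.elim _ _
      map_reindex := fun _ _ _ _ _ _ => Subsingleton.elim _ _
      map_circ := fun _ _ _ _ _ _ _ _ => Subsingleton.elim _ _ }

theorem subtree_vertex (T : DTree) (v : T.V) : T.Subtree (T.inp v) (T.out v) := by
  simpa using (T.isOp_vertex v).2

/-! ### The two kinds of outer faces -/

/-- Chop off a vertex `v` all of whose inputs are leaves. -/
def chopTop (T : DTree) (v : T.V) (hv : ∀ e ∈ T.inp v, T.IsLeaf e) : DTree where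
  E := {e : T.E // e ∉ T.inp v}
  V := {u : T.V // u ≠ v}
  inp u := Subtype.val ⁻¹' T.inp u.1
  out u := ⟨T.out u.1, fun h => hv _ h u.1 rfl⟩
  root := ⟨T.root, T.root_notMem v⟩
  out_injective _ _ h := Subtype.ext (T.out_injective (congrArg Subtype.val h))
  inp_unique h₁ h₂ := Subtype.ext (T.inp_unique h₁ h₂)
  root_notMem u := T.root_notMem u.1
  reach := by
    rintro ⟨e, he⟩
    induction T.reach e using Relation.ReflTransGen.head_induction_on with
    | refl => exact .refl
    | @head a b h _ ih =>
      obtain ⟨w, hw, rfl⟩ := h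
      exact (ih fun h => hv _ h w rfl).head ⟨⟨w, fun h => he (h ▸ hw)⟩, hw, rfl⟩

/-- The outer face `chopTop T v → T`. -/
def chopTopHom (T : DTree) (v : T.V) (hv : ∀ e ∈ T.inp v, T.IsLeaf e) : T.chopTop v hv ⟶ T :=
  homOfSubtree Subtype.val Subtype.val_injective fun u => by
    have h : Subtype.val '' (T.chopTop v hv).inp u = T.inp u.1 :=
      Set.image_preimage_eq_of_subset fun e he =>
        ⟨⟨e, fun h => u.2 (T.inp_unique he h)⟩, rfl⟩
    exact (congrArg (T.Subtree · _) h).mpr (T.subtree_vertex u.1)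

theorem vertexOver_chopTopHom (v : T.V) (hv : ∀ e ∈ T.inp v, T.IsLeaf e) (u : T.V)
    (hu : u ≠ v) : VertexOver (T.chopTopHom v hv) ⟨u, hu⟩ u :=
  ⟨rfl, Set.image_preimage_eq_of_subset fun e he =>
    ⟨⟨e, fun h => hu (T.inp_unique he h)⟩, rfl⟩⟩

theorem isTopFace_chopTopHom (v : T.V) (hv : ∀ e ∈ T.inp v, T.IsLeaf e) :
    IsTopFace (T.chopTopHom v hv) :=
  ⟨v, hv, Subtype.val_injective, Subtype.range_val,
    fun u h => u.2 (T.out_injective h), fun u hu => ⟨_, vertexOver_chopTopHom v hv u hu⟩⟩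

/-- `r` is the root vertex, and all its inputs except possibly `e` are leaves. -/
structure IsChoppableRoot (T : DTree) (r : T.V) (e : T.E) : Prop where
  out_eq : T.out r = T.root
  mem : e ∈ T.inp r
  isLeaf : ∀ e' ∈ T.inp r, e' ≠ e → T.IsLeaf e'

theorem notMem_insert_root_of_mem_inp {r : T.V} {e : T.E}
    {u : T.V} (hu : u ≠ r) {a : T.E} (ha : a ∈ T.inp u) :
    a ∉ insert T.root (T.inp r \ {e}) := by
  rintro (rfl | h')
  · exact T.root_notMem u ha
  · exact hu (T.inp_unique ha h'.1)

/-- Chop off the root vertex. -/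
def chopRoot (T : DTree) {r : T.V} {e : T.E} (h : T.IsChoppableRoot r e) : DTree where
  E := {a : T.E // a ∉ insert T.root (T.inp r \ {e})}
  V := {u : T.V // u ≠ r}
  inp u := Subtype.val ⁻¹' T.inp u.1
  out u := ⟨T.out u.1, by
    rintro (h' | h')
    · exact u.2 (T.out_injective (h'.trans h.out_eq.symm))
    · exact h.isLeaf _ h'.1 h'.2 u.1 rfl⟩
  root := ⟨e, by
    rintro (h' | h')
    · exact T.root_notMem r (h' ▸ h.mem)
    · exact h'.2 rfl⟩
  out_injective _ _ h := Subtype.ext (T.out_injective (congrArg Subtype.val h))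
  inp_unique h₁ h₂ := Subtype.ext (T.inp_unique h₁ h₂)
  root_notMem u hu := u.2 (T.inp_unique hu h.mem)
  reach := by
    rintro ⟨a, ha⟩
    induction T.reach a using Relation.ReflTransGen.head_induction_on with
    | refl => exact (ha (Or.inl rfl)).elim
    | @head a b hab _ ih =>
      obtain ⟨w, hw, rfl⟩ := hab
      by_cases hwr : w = r
      · subst hwr
        have hae : a = e := by
          by_contra hne
          exact ha (Or.inr ⟨hw, hne⟩)
        subst hae
        exact .refl
      · have hb : T.out w ∉ insert T.root (T.inp r \ {e}) := by
          rintro (h' | h')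
          · exact hwr (T.out_injective (h'.trans h.out_eq.symm))
          · exact h.isLeaf _ h'.1 h'.2 w rfl
        exact (ih hb).head ⟨⟨w, hwr⟩, hw, rfl⟩

/-- The outer face `chopRoot T → T`. -/
def chopRootHom (T : DTree) {r : T.V} {e : T.E} (h : T.IsChoppableRoot r e) :
    T.chopRoot h ⟶ T :=
  homOfSubtree Subtype.val Subtype.val_injective fun u => by
    have h : Subtype.val '' (T.chopRoot h).inp u = T.inp u.1 :=
      Set.image_preimage_eq_of_subset fun a ha => ⟨⟨a, notMem_insert_root_of_mem_inp u.2 ha⟩, rfl⟩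
    exact (congrArg (T.Subtree · _) h).mpr (T.subtree_vertex u.1)

theorem vertexOver_chopRootHom {r : T.V} {e : T.E} (h : T.IsChoppableRoot r e) (u : T.V)
    (hu : u ≠ r) : VertexOver (T.chopRootHom h) ⟨u, hu⟩ u :=
  ⟨rfl, Set.image_preimage_eq_of_subset fun a ha => ⟨⟨a, notMem_insert_root_of_mem_inp hu ha⟩, rfl⟩⟩

theorem isRootFace_chopRootHom {r : T.V} {e : T.E} (h : T.IsChoppableRoot r e) :
    IsRootFace (T.chopRootHom h) :=
  ⟨r, e, h.out_eq, h.mem, h.isLeaf, Subtype.val_injective, Subtype.range_val,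
    fun u hu => ⟨_, vertexOver_chopRootHom h u hu⟩⟩

/-! ### Factoring corolla maps through outer faces -/

theorem corolla_edge_injective {J : Type} (v : T.V) (g : J → T.E) (hg : Function.Injective g)
    (hr : Set.range g = T.inp v) :
    Function.Injective fun x : Option J => x.elim (T.out v) g := by
  have hv : ∀ j, g j ≠ T.out v := fun j h => notMem_inp_out v (hr ▸ ⟨j, h⟩)
  rintro (_ | i) (_ | j) h
  · rfl
  · exact (hv j h.symm).elim
  · exact (hv i h).elim
  · exact congrArg some (hg h)

/-- The map from a corolla to the vertex `v`, given by an enumeration of the inputs of `v`. -/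
def corollaHom {J : Type} [Finite J] (v : T.V) (g : J → T.E) (hg : Function.Injective g)
    (hr : Set.range g = T.inp v) : corolla J ⟶ T :=
  homOfSubtree (S := corolla J) (fun x : Option J => x.elim (T.out v) g)
    (corolla_edge_injective v g hg hr) fun _ => by
      have h : (fun x : Option J => x.elim (T.out v) g) '' Set.range some = T.inp v := by
        rw [← Set.range_comp, ← hr]
        rfl
      exact h ▸ T.subtree_vertex v

theorem isIso_corollaHom {J : Type} [Finite J] (v : T.V) (g : J → T.E)
    (hg : Function.Injective g) (hr : Set.range g = T.inp v) (hv : ∀ u, u = v) :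
    IsIso (corollaHom v g hg hr) := by
  have hroot : T.out v = T.root := by
    rcases (Relation.ReflTransGen.cases_tail (T.reach (T.out v))) with h | ⟨b, -, w, -, hw⟩
    · exact h.symm
    · exact (hv w ▸ hw).symm
  have hb : Function.Bijective (corollaHom v g hg hr).edge := by
    refine ⟨corolla_edge_injective v g hg hr, fun e => ?_⟩
    rcases Relation.ReflTransGen.cases_head (T.reach e) with rfl | ⟨b, ⟨w, hw, -⟩, -⟩
    · exact ⟨none, hroot⟩
    · rw [hv w, ← hr] at hw
      obtain ⟨j, rfl⟩ := hw
      exact ⟨some j, rfl⟩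
  let E := Equiv.ofBijective _ hb
  refine ⟨homOfSubtree (T := corolla J) E.symm E.symm.injective fun u => ?_,
    Hom.ext_edge (funext fun x => E.symm_apply_apply x),
    Hom.ext_edge (funext fun x => E.apply_symm_apply x)⟩
  have h1 : E.symm (T.out u) = none := by
    rw [hv u]
    exact E.symm_apply_apply none
  have h2 : E.symm '' T.inp u = Set.range some := by
    rw [hv u, ← hr, ← Set.range_comp]
    exact congrArg Set.range (funext fun j => E.symm_apply_apply (some j))
  rw [h1, h2]
  exact (corolla J).subtree_vertex ()

/-- If the face still contains `v`, the enumeration of its inputs lifts, and the corolla map factors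
through the face. -/
theorem corollaHom_mem_of_vertexOver {T' : DTree} {f : T' ⟶ T} (hf : isoOrFace f)
    (hinj : Function.Injective f.edge) {v' : T'.V} {v : T.V} (hv : VertexOver f v' v)
    (ih : ∀ {J : Type} [Finite J] (g : J → T'.E) (hg : Function.Injective g)
      (hr : Set.range g = T'.inp v'),
      isoOrFace.multiplicativeClosure (corollaHom v' g hg hr))
    {J : Type} [Finite J] (g : J → T.E) (hg : Function.Injective g)
    (hr : Set.range g = T.inp v) : isoOrFace.multiplicativeClosure (corollaHom v g hg hr) := by
  have h : ∀ j, ∃ a ∈ T'.inp v', f.edge a = g j := fun j => by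
    have h1 : g j ∈ f.edge '' T'.inp v' := by
      rw [hv.2, ← hr]
      exact ⟨j, rfl⟩
    exact h1
  choose g' hmem hg' using h
  have hinj' : Function.Injective g' := fun i j hij => hg (by rw [← hg', ← hg', hij])
  have hr' : Set.range g' = T'.inp v' := by
    refine subset_antisymm (Set.range_subset_iff.2 hmem) fun a ha => ?_
    have h1 : f.edge a ∈ Set.range g := by
      rw [hr, ← hv.2]
      exact ⟨a, ha, rfl⟩
    obtain ⟨j, hj⟩ := h1
    exact ⟨j, hinj ((hg' j).trans hj)⟩
  have hcomp : corollaHom v g hg hr = corollaHom v' g' hinj' hr' ≫ f := by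
    refine Hom.ext_edge (funext fun x => ?_)
    rcases x with _ | j
    · exact hv.1.symm
    · exact (hg' j).symm
  rw [hcomp]
  exact .comp_of _ _ (ih g' hinj' hr') hf

theorem wellFounded_step_up (T : DTree) : WellFounded T.Step := by
  have h : IsTrans T.E (Relation.TransGen T.Step) := ⟨fun _ _ _ => Relation.TransGen.trans⟩
  have h' : Std.Irrefl (Relation.TransGen T.Step) := ⟨T.not_transGen_self⟩
  exact Subrelation.wf (fun h => Relation.TransGen.single h)
    (Finite.wellFounded_of_trans_of_irrefl (Relation.TransGen T.Step))

/-- Climb from `u` through inner edges: by finiteness this ends at a vertex with only leaves above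
it, which must be `v`. -/
theorem reach_of_forall_top {v : T.V}
    (h : ∀ w, (∀ e ∈ T.inp w, T.IsLeaf e) → w = v) (u : T.V) :
    Relation.ReflTransGen T.Step (T.out v) (T.out u) := by
  have key : ∀ e, ∀ u, T.out u = e → Relation.ReflTransGen T.Step (T.out v) e := by
    intro e
    induction e using T.wellFounded_step_up.induction with
    | _ e ih =>
      rintro u rfl
      by_cases hu : u = v
      · rw [hu]
      · have h1 : ¬ ∀ e ∈ T.inp u, T.IsLeaf e := fun h1 => hu (h u h1)
        push Not at h1
        obtain ⟨e, he, hl⟩ := h1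
        obtain ⟨w, rfl⟩ := not_isLeaf_iff.1 hl
        exact (ih _ ⟨u, he, rfl⟩ w rfl).tail ⟨u, he, rfl⟩
  exact key _ u rfl

/-- Every vertex lies on the path from `v` to the root, and this path enters `r` through a single
input `e`. An inner edge at another input would be comparable with `e`. -/
theorem exists_isChoppableRoot {v r : T.V}
    (h : ∀ w, (∀ e ∈ T.inp w, T.IsLeaf e) → w = v) (hr : T.out r = T.root) (hrv : v ≠ r) :
    ∃ e, T.IsChoppableRoot r e := by
  have h1 := reach_of_forall_top h r
  rcases Relation.ReflTransGen.cases_tail h1 with h2 | ⟨e, hve, w, hw, hrw⟩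
  · exact (hrv (T.out_injective h2.symm)).elim
  · obtain rfl := T.out_injective hrw
    refine ⟨e, hr, hw, fun e' he' hne => ?_⟩
    by_contra hl
    obtain ⟨u, rfl⟩ := not_isLeaf_iff.1 hl
    have h3 := reach_of_forall_top h u
    rcases Relation.ReflTransGen.total_of_right_unique T.step_rightUnique hve h3 with h4 | h4
    · exact hne ((T.subtree_vertex r).antichain hw he' h4).symm
    · exact hne ((T.subtree_vertex r).antichain he' hw h4)

theorem corollaHom_mem (T : DTree) (v : T.V) {J : Type} [Finite J] (g : J → T.E)
    (hg : Function.Injective g) (hr : Set.range g = T.inp v) :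
    isoOrFace.multiplicativeClosure (corollaHom v g hg hr) := by
  -- The corolla is indexed by an arbitrary `J` with an enumeration `g`, rather than by `T.inp v`,
  -- so that it stays the same while the tree shrinks.
  induction hm : Nat.card T.V using Nat.strong_induction_on generalizing T J with
  | _ m ih =>
    subst hm
    have hcard : ∀ w : T.V, Nat.card {u : T.V // u ≠ w} < Nat.card T.V := fun w =>
      Finite.card_subtype_lt (x := w) (by simp)
    by_cases htop : ∃ w, (∀ e ∈ T.inp w, T.IsLeaf e) ∧ w ≠ v
    · obtain ⟨w, hw, hwv⟩ := htop
      exact corollaHom_mem_of_vertexOver (.inr (.inr (.inl (isTopFace_chopTopHom w hw))))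
        Subtype.val_injective (vertexOver_chopTopHom w hw v hwv.symm)
        (fun g hg hr => ih _ (hcard w) _ _ g hg hr rfl) g hg hr
    · push Not at htop
      obtain ⟨r, hroot⟩ := not_isLeaf_iff.1
        (not_isLeaf_root (T := T) (not_isEmpty_iff.2 ⟨v⟩))
      by_cases hrv : v = r
      · subst hrv
        -- All vertices lie below `v`, which is now the root vertex; hence `v` is the only one.
        refine .of _ (.inl (isIso_corollaHom v g hg hr fun u => ?_))
        have h1 := reach_of_forall_top htop u
        rw [hroot] at h1
        rcases Relation.ReflTransGen.cases_head h1 with h2 | ⟨b, ⟨w, hw, -⟩, -⟩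
        · exact T.out_injective (h2.symm.trans hroot.symm)
        · exact (T.root_notMem w hw).elim
      · obtain ⟨e, he⟩ := exists_isChoppableRoot htop hroot hrv
        exact corollaHom_mem_of_vertexOver (.inr (.inr (.inr (isRootFace_chopRootHom he))))
          Subtype.val_injective (vertexOver_chopRootHom he v hrv)
          (fun g hg hr => ih _ (hcard r) _ _ g hg hr rfl) g hg hr

/-- The inclusion of the corolla at a vertex. -/
def corollaInclusion (T : DTree) (v : T.V) : (corolla (T.inp v)).inj ⟶ T.inj :=
  ⟨corollaHom v Subtype.val Subtype.val_injective Subtype.range_val,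
    corollaHom_mem T v _ _ _⟩

theorem isCorollaInclusion_corollaInclusion (T : DTree) (v : T.V) :
    IsCorollaInclusion T v (T.corollaInclusion v) :=
  ⟨rfl, fun _ => rfl⟩

end DTree

/-! ## The Segal condition and the values at corollas -/

namespace DTree

variable {n : ℕ}

theorem colour_corolla_some {J : Type} [Finite J] (j : J) :
    (corolla J).colour (some j) = .two :=
  colour_of_isLeaf fun _ h => nomatch h

/-- The inputs of the vertex of a corolla. -/
noncomputable def corollaInp (J : Type) [Finite J] : J ≃ (corolla J).inp () :=
  Equiv.ofInjective some (Option.some_injective J)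

theorem opHomeo_aux {I J : Type} [Finite I] [Finite J] (e : I ≃ J) {c : I → Colour}
    {c' : J → Colour} (h : ∀ i, c' (e i) = c i) (x : (pointsDisks n).Op c .one) :
    (pointsDisks n).reindex e.symm (fun j => by rw [← h, e.apply_symm_apply])
      ((pointsDisks n).reindex e h x) = x :=
  opCode_ext fun i => by rw [opCode_reindex, opCode_reindex, e.symm_symm, e.symm_apply_apply]

/-- Relabelling as a homeomorphism. -/
def opHomeo {I J : Type} [Finite I] [Finite J] (e : I ≃ J) {c : I → Colour}
    {c' : J → Colour} (h : ∀ i, c' (e i) = c i) :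
    (pointsDisks n).Op c .one ≃ₜ (pointsDisks n).Op c' .one where
  toFun := (pointsDisks n).reindex e h
  invFun := (pointsDisks n).reindex e.symm fun j => by rw [← h, e.apply_symm_apply]
  left_inv := opHomeo_aux e h
  right_inv := opHomeo_aux e.symm _
  continuous_toFun := (pointsDisks_isOperad n).continuous_reindex e h
  continuous_invFun := (pointsDisks_isOperad n).continuous_reindex e.symm _

/-- The value of `X` at a corolla. -/
noncomputable def corollaHomeo (n : ℕ) (J : Type) [Finite J] :
    LeafMap n (corolla J) ≃ₜ (pointsDisks n).Op (fun _ : J => Colour.two) .one :=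
  (leafMapHomeo n (corolla J)).trans ((Homeomorph.funUnique Unit ((pointsDisks n).Op
    (fun e : (corolla J).inp () => (corolla J).colour e.1) .one)).trans
    (opHomeo (corollaInp J) colour_corolla_some).symm)

theorem opCode_corollaHomeo {J : Type} [Finite J] (F : LeafMap n (corolla J)) (j : J) :
    opCode (corollaHomeo n J F) j =
      opCode (F.toFun ((corolla J).vertexOp ())) ⟨some j, ⟨j, rfl⟩⟩ := by
  refine (opCode_reindex (corollaInp J).symm (fun e => ?_) (F.vertexData ()) j).trans ?_
  · obtain ⟨j, rfl⟩ := (corollaInp J).surjective e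
    exact (colour_corolla_some j).symm
  exact F.opCode_vertexData () _

theorem colour_le_two (k : Colour) : k ≤ .two := fun _ => rfl

/-- Through `leafMapHomeo` on the source and `corollaHomeo` on the targets, the map becomes the
product over the vertices of the shifts that turn all inputs into points. -/
theorem hasPointedSections_segal (n : ℕ) (T : DTree) :
    HasPointedSections (ContinuousMap.pi fun v => (⟨LeafMap.restrict (T.corollaInclusion v).hom
      (edge_injective_of_mem (T.corollaInclusion v).property),
      LeafMap.continuous_restrict _ _⟩ : C(LeafMap n T, LeafMap n (corolla (T.inp v))))) := by
  refine (HasPointedSections.piMap fun v => hasPointedSections_pointsDisksShift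
    (c := fun e : T.inp v => T.colour e.1) (c' := fun _ => .two)
    fun e => colour_le_two _).of_homeomorph (leafMapHomeo n T)
    (Homeomorph.piCongrRight fun v => corollaHomeo n (T.inp v)) fun F => ?_
  refine funext fun v => opCode_ext fun e => ?_
  refine (opCode_corollaHomeo _ _).trans ?_
  refine (LeafMap.opCode_restrict _ (edge_injective_of_mem (T.corollaInclusion v).property) F _
    (not_isLeaf_out (T := corolla (T.inp v)) ()) _).trans ?_
  refine Eq.trans ?_ (opCode_shift _ (F.vertexData v) e).symm
  -- All inputs of a corolla have colour `2`; what remains is that restriction to `v` keeps the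
  -- position of an input relative to the output.
  refine congrArg₂ codeShift (colour_corolla_some e) ?_
  refine (F.opCode_toFun _ (not_isLeaf_out v) _).trans ?_
  exact ((F.opCode_vertexData v e).trans (F.opCode_toFun _ (not_isLeaf_out v) e)).symm

end DTree

theorem segalCondition_pointsDisksSpace (n : ℕ) : SegalCondition (pointsDisksSpace n) :=
  ⟨nonempty_unique_pointsDisksSpace n, fun T _ => ⟨T.corollaInclusion,
    T.isCorollaInclusion_corollaInclusion, (T.hasPointedSections_segal n).isWeakHomotopyEquiv⟩⟩

/-! ### Ordered configuration spaces and the conclusion -/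

/-- The operation given by a configuration of points. -/
def opOfOrderedConfig {n k : ℕ} (p : OrderedConfig n k) :
    (pointsDisks n).Op (fun _ : Fin k => Colour.two) .one :=
  (⟨p.1, p.2.1, fun _ _ hij => p.2.2.ne hij⟩ : DiskConfig n fun _ : Fin k => Colour.two)

/-- Operations with inputs of colour `2` are configurations of points. -/
def opHomeoOrderedConfig (n k : ℕ) :
    (pointsDisks n).Op (fun _ : Fin k => Colour.two) .one ≃ₜ OrderedConfig n k where
  toFun x := ⟨fun i => x.1 i, x.2.1, fun i j hij => by
    by_contra h
    exact x.2.2 i j h hij⟩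
  invFun := opOfOrderedConfig
  left_inv _ := rfl
  right_inv _ := rfl
  continuous_toFun := Continuous.subtype_mk (continuous_pi fun i =>
    (continuous_opCode_apply (n := n) (c := fun _ : Fin k => Colour.two) (d := .one) i).snd) _
  continuous_invFun := by
    refine continuous_op_iff.2 fun i => ?_
    have h : Continuous fun p : OrderedConfig n k => ((0 : ℝ), p.1 i) :=
      continuous_const.prodMk ((continuous_apply i).comp continuous_subtype_val)
    exact h

theorem opHomeoOrderedConfig_apply {n k : ℕ}
    (x : (pointsDisks n).Op (fun _ : Fin k => Colour.two) .one) (i : Fin k) :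
    (opHomeoOrderedConfig n k x).1 i = (opCode x i).2 := rfl

theorem mainTheorem3 (n : ℕ) :
    IsOperadWithShifts (pointsDisks n) (pointsDisksShift n) ∧
    (∀ {I : Type} [Finite I] {c c' : I → Colour} (h : ∀ i, c i ≤ c' i),
      ∃ e : ContinuousMap.HomotopyEquiv ((pointsDisks n).Op c .one) ((pointsDisks n).Op c' .one),
        ∀ x, e x = pointsDisksShift n h x) ∧
    ∃ (X : SemiDendroidalSpace) (A : AssociatedTo (pointsDisks n) (pointsDisksShift n) X),
      SegalCondition X ∧
      ∀ k : ℕ, ∃ φ : X.obj (.op (DTree.corolla (Fin k)).inj) ≃ₜ OrderedConfig n k,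
        ∀ x i, (φ x).1 i = corollaPoint (A.homeo _ (corolla_not_trivial (Fin k)) x) i := by
  refine ⟨pointsDisks_isOperadWithShifts n, fun {I _ c c'} h =>
    (hasPointedSections_pointsDisksShift h).exists_homotopyEquiv, pointsDisksSpace n,
    pointsDisksSpaceAssociated n, segalCondition_pointsDisksSpace n, fun k =>
    ⟨(DTree.corollaHomeo n (Fin k)).trans (opHomeoOrderedConfig n k), fun F i => ?_⟩⟩
  refine (opHomeoOrderedConfig_apply _ i).trans ?_
  refine (congrArg Prod.snd (DTree.opCode_corollaHomeo F i)).trans ?_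
  refine Eq.trans ?_ (Item.centre_eq _).symm
  exact congrArg Prod.snd (opCode_recolor (DTree.colour_out (T := DTree.corolla (Fin k)) ())
    (OperadMap.toFun (P := (DTree.corolla (Fin k)).operad) (Q := pointsDisks n) F
      ((DTree.corolla (Fin k)).vertexOp ())) ⟨some i, ⟨i, rfl⟩⟩).symm
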